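/- Let $L,n_0\ge 0$ and $n_i,n_{-i}\ge 0$ ($i=1,\dots,L$) be integers, $n=\sum_{i=1}^L(n_i+n_{-i})$, and let $A_{TT}\in\mathbb R^{n_0\times n_0}$, $A_{TS}\in\mathbb R^{n_0\times n}$, $A_{ST}\in\mathbb R^{n\times n_0}$, $A_{SS}\in\mathbb R^{n\times n}$. Let $0\le l\le L$ and let $N_{l+1},\dots,N_L\ge 1$ be integers. Put $\mathbb D_i=\mathbb Z$ for $i\le l$ and $\mathbb D_i=\mathbb Z/N_i\mathbb Z$ for $i>l$, and let $\ell_2$ be the space of square-summable functions $\mathbb D_1\times\cdots\times\mathbb D_L\to\mathbb R^{n}$. Let $\Delta=\mathrm{diag}(\mathbf S_1I_{n_1},\mathbf S_1^{-1}I_{n_{-1}},\dots,\mathbf S_LI_{n_L},\mathbf S_L^{-1}I_{n_{-L}})$ on $\ell_2$, where $(\mathbf S_iu)(\mathbf k)=u(\mathbf k+\mathbf e_i)$. Assume that the system is well-posed: the bounded operator $\Delta-A_{SS}$ is invertible on $\ell_2$. Let $\mathbb T$ be the unit circle, $\mathbb S_i=\{z\in\mathbb T: z^{N_i}=1\}$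 for $i>l$, and $\mathbb G=\mathbb T^l\times\mathbb S_{l+1}\times\cdots\times\mathbb S_L$. For $\mathbf z=(z_1,\dots,z_L)\in\mathbb T^L$ let $\Delta(\mathbf z)=\mathrm{diag}(z_1I_{n_1},z_1^{-1}I_{n_{-1}},\dots,z_LI_{n_L},z_L^{-1}I_{n_{-L}})$ and $$A(\mathbf z)=A_{TT}+A_{TS}(\Delta(\mathbf z)-A_{SS})^{-1}A_{ST}\ \ (\mathbf z\in\mathbb G),\qquad h(\mathbf z)=\det(\Delta(\mathbf z)-A_{SS}),$$ $$H(\mathbf z)=A_{TT}h(\mathbf z)+A_{TS}\,\mathrm{adj}(\Delta(\mathbf z)-A_{SS})A_{ST},\qquad K(\mathbf z)=H(\mathbf z)\overline{h(\mathbf z)}.$$ Write $m(\lambda,\mathbf z)=\det(\lambda I_{n_0}-K(\mathbf z))=\sum_{i=0}^{n_0}m_i(\mathbf z)\lambda^i$, $m_{conj}(\lambda,\mathbf z)=\sum_{i=0}^{n_0}\overline{m_i(\mathbf z)}\lambda^i$ and $\varphi(\lambda,\mathbf z)=m(\lambda,\mathbf z)m_{conj}(\lambda,\mathbf z)=\sum_{i=0}^{2n_0}\varphi_i(\mathbf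 z)\lambda^i$; here $h$, $m_i$, $\varphi_i$ are trigonometric (Laurent) polynomials in $\mathbf z$, and the conjugate of $\sum f(\mathbf d)\mathbf z^{\mathbf d}$ is $\sum \overline{f(\mathbf d)}\mathbf z^{-\mathbf d}$. In the field of rational functions generated by the trigonometric polynomials, form the Routh–Hurwitz table of $\varphi$: $e_{0,j}=\varphi_{2n_0-2j}$ for $0\le j\le n_0$, $e_{1,j}=\varphi_{2n_0-2j-1}$ for $0\le j\le n_0-1$, further entries of these two rows being $0$, and $$e_{i,j}=\frac{e_{i-2,j+1}\,e_{i-1,0}-e_{i-2,0}\,e_{i-1,j+1}}{e_{i-1,0}}\qquad(2\le i\le 2n_0,\ j\ge 0),$$ where a quotient with identically zero denominator is read as $0$. Normalize the first column by $\bar e_{0,0}=e_{0,0}$ and $\bar e_{i,0}=e_{i,0}\,\hat e_{i,0}$, $\hat e_{i,0}=\prod_{k=i-1,i-3,\dots;\,k\ge 0}\bar e_{k,0}$ for $1\le i\le 2n_0$. Then every $\bar e_{i,0}$, $0\le i\le 2n_0$, is a real-valued (Hermitian) trigonometric polynomial, i.e. of the form $\sum f(\mathbf d)\mathbf z^{\mathbf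 d}$ with $f(-\mathbf d)=\overline{f(\mathbf d)}$, and the following are equivalent: 1. $A(\mathbf z)$ is Hurwitz (all its eigenvalues have negative real part) for every $\mathbf z\in\mathbb G$; 2. (i) no $\bar e_{i,0}$ with $0\le i\le 2n_0$ is a non-positive constant, and (ii) every non-constant polynomial among $\bar e_{0,0},\dots,\bar e_{2n_0,0}$ is positive at every point of $\mathbb G$. -/

import Mathlib

open scoped ENNReal Matrix

noncomputable section

/-! ## The spatially interconnected system -/

/-- Index set of the interconnection variables `v = (v₁; v₋₁; …; v_L; v₋L)`: for every direction `i`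
a block `v_i` of size `np i` (`Sum.inl`) followed by a block `v₋ᵢ` of size `nm i` (`Sum.inr`). -/
abbrev IntIdx {L : ℕ} (np nm : Fin L → ℕ) : Type := Σ i : Fin L, Fin (np i) ⊕ Fin (nm i)

/-- The real matrices of a system with `L` spatial directions, state dimension `n₀` and
interconnection dimensions `np i = n_i`, `nm i = n_{-i}`. -/
structure SIS (L n₀ : ℕ) (np nm : Fin L → ℕ) where
  ATT : Matrix (Fin n₀) (Fin n₀) ℝ
  ATS : Matrix (Fin n₀) (IntIdx np nm) ℝ
  AST : Matrix (IntIdx np nm) (Fin n₀) ℝ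
  ASS : Matrix (IntIdx np nm) (IntIdx np nm) ℝ

/-- The `i`-th spatial variable ranges over `ℤ` for the first `l` directions (`ZMod 0` is `ℤ`) and
over `ℤ / N i` for the others. -/
def spatialPeriod {L : ℕ} (l : ℕ) (N : Fin L → ℕ) (i : Fin L) : ℕ :=
  if (i : ℕ) < l then 0 else N i

/-- The spatial domain `𝔻₁ × ⋯ × 𝔻_L`. -/
abbrev SpatialDomain {L : ℕ} (l : ℕ) (N : Fin L → ℕ) : Type :=
  ∀ i : Fin L, ZMod (spatialPeriod l N i)

/-! ## Operators on `ℓ₂` and well-posedness -/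

section Operators

variable {D : Type} {ι : Type} [Fintype ι]

/-- Square-summable signals `D → ℝ^ι`, with the Euclidean norm on `ℝ^ι`. -/
abbrev EllTwo (D ι : Type) [Fintype ι] : Type :=
  lp (fun _ : D => EuclideanSpace ℝ ι) 2

theorem memlp_pointwise (T : EuclideanSpace ℝ ι →L[ℝ] EuclideanSpace ℝ ι) (x : EllTwo D ι) :
    Memℓp (fun k => T (x k)) 2 := by
  have h := (lp.memℓp x).summable (by norm_num)
  refine memℓp_gen (Summable.of_nonneg_of_le (fun k => by positivity) (fun k => ?_)
    (h.mul_left (‖T‖ ^ (2 : ℝ≥0∞).toReal)))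
  rw [← Real.mul_rpow (norm_nonneg _) (norm_nonneg _)]
  exact Real.rpow_le_rpow (norm_nonneg _) (T.le_opNorm _) (by norm_num)

/-- The operator `(T x)(k) = T (x(k))` on `ℓ₂`. -/
def pointwiseOp (T : EuclideanSpace ℝ ι →L[ℝ] EuclideanSpace ℝ ι) :
    EllTwo D ι →L[ℝ] EllTwo D ι :=
  LinearMap.mkContinuous
    { toFun := fun x => ⟨fun k => T (x k), memlp_pointwise T x⟩
      map_add' := fun x y => by ext1; funext k; exact T.map_add _ _
      map_smul' := fun c x => by ext1; funext k; exact T.map_smul _ _ }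
    ‖T‖ (fun x => by
      have h := (lp.memℓp x).summable (p := 2) (by norm_num)
      refine lp.norm_le_of_forall_sum_le (p := 2) (by norm_num) (by positivity) (fun s => ?_)
      rw [Real.mul_rpow (norm_nonneg _) (norm_nonneg _)]
      refine le_trans (Finset.sum_le_sum (fun k _ => ?_)) (le_trans (Finset.mul_sum _ _ _).symm.le
        (mul_le_mul_of_nonneg_left (lp.sum_rpow_le_norm_rpow (by norm_num) x s) (by positivity)))
      rw [← Real.mul_rpow (norm_nonneg _) (norm_nonneg _)]
      exact Real.rpow_le_rpow (norm_nonneg _) (T.le_opNorm _) (by norm_num))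

theorem pointwiseOp_apply (T : EuclideanSpace ℝ ι →L[ℝ] EuclideanSpace ℝ ι) (x : EllTwo D ι)
    (k : D) : pointwiseOp T x k = T (x k) := rfl

theorem memlp_translate [AddCommGroup D] (s : D) (x : EllTwo D ι) :
    Memℓp (fun k => x (k + s)) 2 := by
  have h : Summable fun k => ‖x k‖ ^ (2 : ℝ≥0∞).toReal := (lp.memℓp x).summable (by norm_num)
  exact memℓp_gen (h.comp_injective (add_left_injective s))

/-- The translation `(S x)(k) = x(k + s)` on `ℓ₂`. -/
def translateOp [AddCommGroup D] (s : D) : EllTwo D ι →L[ℝ] EllTwo D ι :=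
  LinearMap.mkContinuous
    { toFun := fun x => ⟨fun k => x (k + s), memlp_translate s x⟩
      map_add' := fun x y => by ext1; funext k; rfl
      map_smul' := fun c x => by ext1; funext k; rfl }
    1 (fun x => by
      rw [one_mul]
      refine lp.norm_le_of_tsum_le (p := 2) (by norm_num) (norm_nonneg _) (le_of_eq ?_)
      rw [lp.norm_rpow_eq_tsum (by norm_num) x]
      exact (Equiv.addRight s).tsum_eq (fun k => ‖x k‖ ^ (2 : ℝ≥0∞).toReal))

theorem translateOp_apply [AddCommGroup D] (s : D) (x : EllTwo D ι) (k : D) :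
    translateOp s x k = x (k + s) := rfl

end Operators

/-- The lattice step attached to an interconnection variable: `+eᵢ` for the components of `v_i`
and `-eᵢ` for those of `v₋ᵢ`. -/
def shiftStep {L : ℕ} (l : ℕ) (N : Fin L → ℕ) {np nm : Fin L → ℕ} :
    IntIdx np nm → SpatialDomain l N
  | ⟨i, Sum.inl _⟩ => Pi.single i 1
  | ⟨i, Sum.inr _⟩ => -Pi.single i 1

/-- The structured operator `Δ = diag(S₁ I, S₁⁻¹ I, …, S_L I, S_L⁻¹ I)` on `ℓ₂`, where
`(S_i u)(k) = u(k + e_i)`; see `deltaOp_apply`. -/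
def deltaOp {L : ℕ} (l : ℕ) (N np nm : Fin L → ℕ) :
    EllTwo (SpatialDomain l N) (IntIdx np nm) →L[ℝ] EllTwo (SpatialDomain l N) (IntIdx np nm) :=
  ∑ j : IntIdx np nm,
    (pointwiseOp (Matrix.toEuclideanCLM (𝕜 := ℝ) (Matrix.single j j 1))).comp
      (translateOp (shiftStep l N j))

theorem deltaOp_apply {L : ℕ} (l : ℕ) (N np nm : Fin L → ℕ)
    (v : EllTwo (SpatialDomain l N) (IntIdx np nm)) (k : SpatialDomain l N) (j : IntIdx np nm) :
    deltaOp l N np nm v k j = v (k + shiftStep l N j) j := by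
  rw [deltaOp, _root_.sum_apply, lp.coeFn_sum]
  change (((∑ i, fun k => _) : SpatialDomain l N → EuclideanSpace ℝ (IntIdx np nm)) k).ofLp j = _
  rw [Finset.sum_apply]
  simp [pointwiseOp_apply, translateOp_apply,
    Matrix.ofLp_toEuclideanCLM, Matrix.single_mulVec, Function.update_apply]

/-- Well-posedness: the bounded operator `Δ - A_SS` is invertible on `ℓ₂`. -/
def SIS.WellPosed {L n₀ : ℕ} {np nm : Fin L → ℕ} (S : SIS L n₀ np nm) (l : ℕ) (N : Fin L → ℕ) :
    Prop :=
  IsUnit (deltaOp l N np nm - pointwiseOp (Matrix.toEuclideanCLM (𝕜 := ℝ) S.ASS))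

/-! ## The transformed matrix `A(z)` -/

/-- `𝔾 = 𝕋^l × 𝕊_{l+1} × ⋯ × 𝕊_L` with `𝕊_i` the `N i`-th roots of unity. -/
def torusG {L : ℕ} (l : ℕ) (N : Fin L → ℕ) : Set (Fin L → ℂ) :=
  {z | (∀ i, ‖z i‖ = 1) ∧ ∀ i : Fin L, l ≤ (i : ℕ) → z i ^ N i = 1}

/-- The diagonal entries `z_i` (for `v_i`) and `z_i⁻¹` (for `v₋ᵢ`) of `Δ(z)`. -/
def deltaEntry {L : ℕ} {np nm : Fin L → ℕ} (z : Fin L → ℂ) : IntIdx np nm → ℂ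
  | ⟨i, Sum.inl _⟩ => z i
  | ⟨i, Sum.inr _⟩ => (z i)⁻¹

/-- `A(z) = A_TT + A_TS (Δ(z) - A_SS)⁻¹ A_ST`. -/
def SIS.A {L n₀ : ℕ} {np nm : Fin L → ℕ} (S : SIS L n₀ np nm) (z : Fin L → ℂ) :
    Matrix (Fin n₀) (Fin n₀) ℂ :=
  S.ATT.map Complex.ofReal + S.ATS.map Complex.ofReal *
    (Matrix.diagonal (deltaEntry z) - S.ASS.map Complex.ofReal)⁻¹ * S.AST.map Complex.ofReal

/-- All eigenvalues have negative real part. -/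
def IsHurwitz {n : ℕ} (M : Matrix (Fin n) (Fin n) ℂ) : Prop :=
  ∀ μ ∈ spectrum ℂ M, μ.re < 0

/-! ## Trigonometric polynomials -/

/-- Trigonometric (Laurent) polynomials `∑ f(d) z^d`, `d ∈ ℤ^L`, with complex coefficients. -/
abbrev TrigPoly (L : ℕ) : Type := AddMonoidAlgebra ℂ (Fin L → ℤ)

namespace TrigPoly

variable {L : ℕ}

/-- The constant polynomial `c`. -/
def const (c : ℂ) : TrigPoly L := AddMonoidAlgebra.single 0 c

/-- The value `p(z) = ∑ f(d) ∏ z_i ^ d_i`. -/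
def eval (z : Fin L → ℂ) (p : TrigPoly L) : ℂ :=
  p.coeff.sum fun d c => c * ∏ i, z i ^ d i

/-- The conjugate: `f(d)` is replaced by the complex conjugate of `f(-d)`, so that on the unit
`L`-circle the values are conjugated; see `eval_conj`. -/
def conj : TrigPoly L →+* TrigPoly L :=
  (AddMonoidAlgebra.mapDomainRingHom ℂ (negAddMonoidHom : (Fin L → ℤ) →+ (Fin L → ℤ))).comp
    (AddMonoidAlgebra.mapRingHom (Fin L → ℤ) (starRingEnd ℂ))

/-- Real-valued (Hermitian) trigonometric polynomials: `f(-d) = f(d)^*`. -/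
def IsHermitian (p : TrigPoly L) : Prop :=
  ∀ d : Fin L → ℤ, p.coeff (-d) = starRingEnd ℂ (p.coeff d)

theorem eval_single (z : Fin L → ℂ) (d : Fin L → ℤ) (c : ℂ) :
    eval z (AddMonoidAlgebra.single d c) = c * ∏ i, z i ^ d i := by
  simp [eval]

theorem eval_add (z : Fin L → ℂ) (p q : TrigPoly L) : eval z (p + q) = eval z p + eval z q := by
  simp only [eval, AddMonoidAlgebra.coeff_add]
  exact Finsupp.sum_add_index' (fun _ => by simp) (fun _ _ _ => by ring)

theorem eval_conj (z : Fin L → ℂ) (hz : ∀ i, ‖z i‖ = 1) (p : TrigPoly L) :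
    eval z (conj p) = starRingEnd ℂ (eval z p) := by
  induction p using AddMonoidAlgebra.induction_linear with
  | zero => simp [eval]
  | add p q hp hq => simp [eval_add, hp, hq]
  | single d c =>
    have h : conj (AddMonoidAlgebra.single d c) = AddMonoidAlgebra.single (-d) (starRingEnd ℂ c) := by
      simp [conj]
    rw [h, eval_single, eval_single, map_mul, map_prod]
    congr 1
    refine Finset.prod_congr rfl fun i _ => ?_
    rw [map_zpow₀, ← Complex.inv_eq_conj (hz i), Pi.neg_apply, zpow_neg, inv_zpow]

end TrigPoly

/-! ## The characteristic polynomial and the Routh–Hurwitz table -/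

/-- The field of rational functions generated by trigonometric polynomials. -/
abbrev TrigRat (L : ℕ) : Type := FractionRing (TrigPoly L)

/-- The diagonal entries of `Δ(z)` as trigonometric polynomials. -/
def deltaMono {L : ℕ} {np nm : Fin L → ℕ} : IntIdx np nm → TrigPoly L
  | ⟨i, Sum.inl _⟩ => AddMonoidAlgebra.single (Pi.single i 1) 1
  | ⟨i, Sum.inr _⟩ => AddMonoidAlgebra.single (-Pi.single i 1) 1

/-- A real matrix as a matrix of constant trigonometric polynomials. -/
def constMat (L : ℕ) {m n : Type} (M : Matrix m n ℝ) : Matrix m n (TrigPoly L) :=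
  M.map fun a => TrigPoly.const (a : ℂ)

namespace SIS

variable {L n₀ : ℕ} {np nm : Fin L → ℕ} (S : SIS L n₀ np nm)

/-- `Δ(z) - A_SS`. -/
def pencil : Matrix (IntIdx np nm) (IntIdx np nm) (TrigPoly L) :=
  Matrix.diagonal deltaMono - constMat L S.ASS

/-- `h(z) = det(Δ(z) - A_SS)`. -/
def h : TrigPoly L := S.pencil.det

/-- `H(z) = A_TT h(z) + A_TS adj(Δ(z) - A_SS) A_ST`. -/
def H : Matrix (Fin n₀) (Fin n₀) (TrigPoly L) :=
  S.h • constMat L S.ATT + constMat L S.ATS * S.pencil.adjugate * constMat L S.AST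

/-- `K(z) = H(z) conj(h(z))`. -/
def K : Matrix (Fin n₀) (Fin n₀) (TrigPoly L) := TrigPoly.conj S.h • S.H

/-- `m(λ, z) = det(λ I - K(z))`, a polynomial in `λ`. -/
def m : Polynomial (TrigPoly L) := S.K.charpoly

/-- `m_conj(λ, z)`: the coefficients of `m` are conjugated, `λ` is not. -/
def mConj : Polynomial (TrigPoly L) := S.m.map TrigPoly.conj

/-- `φ(λ, z) = m(λ, z) m_conj(λ, z)`. -/
def phi : Polynomial (TrigPoly L) := S.m * S.mConj

/-- The Routh–Hurwitz table `e_{i,j}` of `φ`, computed with rational functions; the entries of the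
first two rows beyond the coefficients of `φ` are `0`. Once some `e_{i,0}` is identically zero, the
division by zero makes all later first-column entries `0`. -/
def e : ℕ → ℕ → TrigRat L
  | 0, j => if j ≤ n₀ then algebraMap _ _ (S.phi.coeff (2 * n₀ - 2 * j)) else 0
  | 1, j => if j < n₀ then algebraMap _ _ (S.phi.coeff (2 * n₀ - 2 * j - 1)) else 0
  | i + 2, j => (e i (j + 1) * e (i + 1) 0 - e i 0 * e (i + 1) (j + 1)) / e (i + 1) 0

/-- `ê_{i,0} = ∏_{k = i-1, i-3, …} ē_{k,0}`, where `ē_{k,0} = e_{k,0} ê_{k,0}`;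
see `eHat_eq_prod`. -/
def eHat : ℕ → TrigRat L
  | 0 => 1
  | 1 => S.e 0 0 * 1
  | i + 2 => S.e (i + 1) 0 * eHat (i + 1) * eHat i

/-- The normalized first-column entry `ē_{i,0} = e_{i,0} ê_{i,0}`. -/
def eBar (i : ℕ) : TrigRat L := S.e i 0 * S.eHat i

theorem eHat_eq_prod (i : ℕ) :
    S.eHat i = ∏ k ∈ (Finset.range i).filter (fun k => Odd (i - k)), S.eBar k := by
  induction i using Nat.strong_induction_on with
  | _ i ih =>
    match i with
    | 0 => simp [eHat]
    | 1 => simp [eHat, eBar, Finset.prod_filter]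
    | i + 2 =>
      have h2 : (Finset.range (i + 2)).filter (fun k => Odd (i + 2 - k)) =
          insert (i + 1) ((Finset.range i).filter (fun k => Odd (i - k))) := by
        ext k
        simp only [Finset.mem_filter, Finset.mem_range, Finset.mem_insert, Nat.odd_iff]
        omega
      rw [h2, Finset.prod_insert (by simp), ← ih i (by omega), eHat, eBar]

/-- The indices `i = 0, …, 2n₀` for which `ē_{i,0}` is a non-positive constant. -/
def setN : Set ℕ :=
  {i | i ≤ 2 * n₀ ∧ ∃ c : ℝ, c ≤ 0 ∧ S.eBar i = algebraMap _ _ (TrigPoly.const (L := L) (c : ℂ))}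

/-- The polynomials `F_k`: the non-constant polynomials among the `ē_{i,0}`, `i = 0, …, 2n₀`. -/
def setF : Set (TrigPoly L) :=
  {p | (∃ i ≤ 2 * n₀, S.eBar i = algebraMap _ _ p) ∧ ¬ ∃ c : ℂ, p = TrigPoly.const c}

end SIS

end

/-! At a point of the unit torus where `Δ(z) - A_SS` is invertible, `K(z) = |h(z)|² A(z)`
(`SIS.map_K`), so `A(z)` is Hurwitz iff all roots of `m(·, z)` lie in the open left half-plane.
Since `φ(x, z)` is `m(x, z)` times the conjugate of `m(conj x, z)`, it has real coefficients and its
roots are those of `m` and their conjugates; its stability is the same condition, and the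
Routh–Hurwitz criterion decides it.

Well-posedness supplies the invertibility (`SIS.det_ne_zero_of_wellPosed`): a kernel vector of the
symbol at some `z ∈ 𝔾` gives a plane wave which, damped by a slowly varying square-summable weight,
is almost annihilated by `Δ - A_SS`, against the bounded inverse.

The criterion (`RouthHurwitz.isStable_iff_routh_pos`) reads table rows as polynomials. With `p`, `q`
of opposite parity, one step replaces `(p, q)` by `(q, p - c X q)`, where `c` is the quotient of
leading coefficients. If `p + q` is stable, then `Re (p / q) ≥ c Re x` on the right half-plane, by
Julia's inequality for the Blaschke product `(p - q) / (p + q)`. This bound carries stability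
through the step in both directions.

The table is symbolic, the test pointwise. The normalizing factors clear all denominators, so
`ē_{i,0}` is a polynomial (`routhNum`), and its value at `z` is the normalized entry of the
numerical table as long as no earlier entry vanishes at `z` (`map_routhNum_eq`). Positivity of the
earlier entries excludes such vanishing. Constant entries are real by Hermitian symmetry, whence the
split in condition 2. -/

open Polynomial in
/-- `p` has no zeros in the closed right half-plane. -/
def Polynomial.IsStable (p : ℝ[X]) : Prop := ∀ x : ℂ, 0 ≤ x.re → aeval x p ≠ 0

/-- `p` has no monomials other than `X ^ n, X ^ (n - 2), X ^ (n - 4), …`. -/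
def Polynomial.HasParity (p : Polynomial ℝ) (n : ℕ) : Prop :=
  ∀ k, p.coeff k ≠ 0 → ∃ j, k + 2 * j = n

/-! ### One Routh step for real stable polynomials. -/

namespace RouthHurwitz

open Polynomial

/-- The induction step of Julia's inequality. Multiplying the two hypotheses bounds `ρUV` by the
geometric mean of `Aq` and `ap`, hence by half their sum. -/
theorem weighted_cauchy_schwarz {ρ A a p q U V : ℝ} (hρ : 0 ≤ ρ) (hA : 0 ≤ A) (ha : 0 ≤ a)
    (hp : 0 ≤ p) (hq : 0 ≤ q) (hU : ρ * U ^ 2 ≤ A * p) (hV : ρ * V ^ 2 ≤ a * q) :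
    ρ * (U + V) ^ 2 ≤ (A + a) * (p + q) := by
  have h1 : (ρ * U * V) ^ 2 ≤ (A * q) * (a * p) := by
    calc (ρ * U * V) ^ 2 = (ρ * U ^ 2) * (ρ * V ^ 2) := by ring
      _ ≤ (A * p) * (a * q) := by gcongr
      _ = _ := by ring
  have h2 : 2 * (ρ * U * V) ≤ A * q + a * p := by
    refine le_of_sq_le_sq ?_ (by positivity)
    nlinarith [sq_nonneg (A * q - a * p)]
  nlinarith

/-- A half-plane form of Julia's inequality for the Blaschke product `∏ (x + r̄) / (x - r)`. -/
theorem julia_inequality (x : ℂ) (hx : 0 ≤ x.re) (s : Multiset ℂ) (hs : ∀ r ∈ s, r.re < 0) :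
    0 ≤ (s.map fun r => -r.re).sum ∧
    ‖(s.map fun r => x + starRingEnd ℂ r).prod‖ ^ 2 ≤ ‖(s.map fun r => x - r).prod‖ ^ 2 ∧
    x.re * ‖(s.map fun r => x - r).prod - (s.map fun r => x + starRingEnd ℂ r).prod‖ ^ 2 ≤
      (s.map fun r => -r.re).sum * (‖(s.map fun r => x - r).prod‖ ^ 2 -
        ‖(s.map fun r => x + starRingEnd ℂ r).prod‖ ^ 2) := by
  induction s using Multiset.induction_on with
  | empty => simp
  | cons r s ih =>
    obtain ⟨hA, hD, hI⟩ := ih fun t ht => hs t (Multiset.mem_cons_of_mem ht)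
    have hr : 0 ≤ -r.re := by linarith [hs r (Multiset.mem_cons_self r s)]
    simp only [Multiset.map_cons, Multiset.sum_cons, Multiset.prod_cons]
    generalize (s.map fun r => x - r).prod = F at *
    generalize (s.map fun r => x + starRingEnd ℂ r).prod = G at *
    generalize (s.map fun r => -r.re).sum = A at *
    have h1 : ‖x - r‖ ^ 2 = ‖x + starRingEnd ℂ r‖ ^ 2 + 4 * -r.re * x.re := by
      simp only [Complex.sq_norm, Complex.normSq_apply, Complex.add_re, Complex.sub_re,
        Complex.add_im, Complex.sub_im, Complex.conj_re, Complex.conj_im]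
      ring
    have h2 : (x - r) * F - (x + starRingEnd ℂ r) * G =
        (x - r) * (F - G) + (2 * -r.re : ℝ) * G := by
      have : starRingEnd ℂ r = 2 * (r.re : ℂ) - r := by
        have := Complex.add_conj r
        push_cast at this
        linear_combination this
      rw [this]
      push_cast
      ring
    refine ⟨by positivity, ?_, ?_⟩
    · rw [norm_mul, norm_mul, mul_pow, mul_pow]
      refine mul_le_mul ?_ hD (by positivity) (by positivity)
      nlinarith [mul_nonneg hr hx]
    · rw [h2]
      have h3 : ‖(x - r) * (F - G) + (2 * -r.re : ℝ) * G‖ ^ 2 ≤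
          (‖x - r‖ * ‖F - G‖ + 2 * -r.re * ‖G‖) ^ 2 := by
        refine pow_le_pow_left₀ (norm_nonneg _) ((norm_add_le _ _).trans (le_of_eq ?_)) 2
        rw [norm_mul, norm_mul, Complex.norm_real, Real.norm_of_nonneg (by positivity)]
      -- By `h1`, the sum `p + q` of these choices is the new difference of squared norms, and `A -
      -- r.re` is the new weight.
      have h4 := weighted_cauchy_schwarz (U := ‖x - r‖ * ‖F - G‖) (V := 2 * -r.re * ‖G‖)
        (p := ‖x - r‖ ^ 2 * (‖F‖ ^ 2 - ‖G‖ ^ 2)) (q := 4 * -r.re * x.re * ‖G‖ ^ 2) hx hA hr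
        (mul_nonneg (by positivity) (by linarith)) (by positivity)
        (by nlinarith [sq_nonneg ‖x - r‖]) (by nlinarith)
      calc _ ≤ _ := mul_le_mul_of_nonneg_left h3 hx
        _ ≤ _ := h4
        _ = _ := by rw [norm_mul, norm_mul, mul_pow, mul_pow, h1]; ring

theorem aeval_neg_of_hasParity {p : ℝ[X]} {n : ℕ} (hp : p.HasParity n) (x : ℂ) :
    aeval (-x) p = (-1) ^ n * aeval x p := by
  rw [aeval_eq_sum_range, aeval_eq_sum_range, Finset.mul_sum]
  refine Finset.sum_congr rfl fun k _ => ?_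
  by_cases hk : p.coeff k = 0
  · simp [hk]
  · obtain ⟨j, rfl⟩ := hp k hk
    rw [neg_pow, pow_add, pow_mul]
    simp only [Complex.real_smul, even_two, Even.neg_pow, one_pow, mul_one]
    ring

theorem natDegree_le_of_hasParity {p : ℝ[X]} {n : ℕ} (hp : p.HasParity n) : p.natDegree ≤ n :=
  natDegree_le_iff_coeff_eq_zero.2 fun k hk => by
    by_contra h
    obtain ⟨j, hj⟩ := hp k h
    omega

theorem four_mul_re_mul_conj (u v : ℂ) :
    4 * (u * starRingEnd ℂ v).re = ‖u + v‖ ^ 2 - ‖u - v‖ ^ 2 := by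
  simp only [Complex.sq_norm, Complex.normSq_apply, Complex.add_re, Complex.sub_re, Complex.mul_re,
        Complex.add_im, Complex.sub_im, Complex.conj_re, Complex.conj_im]
  ring

section Stable

variable {p q : ℝ[X]} {n : ℕ}

theorem natDegree_add_of_hasParity (hp : p.HasParity (n + 1)) (hq : q.HasParity n)
    (hlead : 0 < p.coeff (n + 1)) : (p + q).natDegree = n + 1 := by
  have hq' := natDegree_le_of_hasParity hq
  have hp' := natDegree_le_of_hasParity hp
  refine natDegree_eq_of_le_of_coeff_ne_zero ?_ ?_
  · exact (natDegree_add_le _ _).trans (by omega)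
  · rw [coeff_add, coeff_eq_zero_of_natDegree_lt (p := q) (by omega)]
    simpa using ne_of_gt hlead

/-- The quotient `p / q` of the two parts of a stable polynomial satisfies
`Re (p / q) ≥ c Re x` with `c` the quotient of the leading coefficients. -/
theorem re_part_quotient_of_isStable (hp : p.HasParity (n + 1)) (hq : q.HasParity n)
    (hlead : 0 < p.coeff (n + 1)) (hst : (p + q).IsStable) :
    0 < q.coeff n ∧ ∀ x : ℂ, 0 ≤ x.re → p.coeff (n + 1) * x.re * ‖aeval x q‖ ^ 2 ≤
      q.coeff n * (aeval x p * starRingEnd ℂ (aeval x q)).re := by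
  set f := (p + q).map (algebraMap ℝ ℂ) with hf
  have hdeg := natDegree_add_of_hasParity hp hq hlead
  have hdegf : f.natDegree = n + 1 := by rw [hf, natDegree_map, hdeg]
  have hsp : f.Splits := IsAlgClosed.splits f
  have hlc : f.leadingCoeff = (p.coeff (n + 1) : ℂ) := by
    rw [leadingCoeff, hdegf, hf, coeff_map, coeff_add,
      coeff_eq_zero_of_natDegree_lt (p := q) (by have := natDegree_le_of_hasParity hq; omega)]
    simp
  have hev : ∀ x : ℂ, f.eval x = aeval x (p + q) := fun x => by
    rw [hf, eval_map_algebraMap]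
  have hf0 : f ≠ 0 := by
    intro h; rw [h] at hdegf; simp at hdegf
  have hroots : ∀ r ∈ f.roots, r.re < 0 := fun r hr => by
    by_contra h
    refine hst r (not_lt.1 h) ?_
    rw [← hev]; exact (mem_roots hf0).1 hr
  have hcard : f.roots.card = n + 1 := by rw [← hsp.natDegree_eq_card_roots, hdegf]
  have hprod : ∀ x : ℂ, aeval x (p + q) =
      p.coeff (n + 1) * (f.roots.map fun r => x - r).prod := fun x => by
    rw [← hev, hsp.eval_eq_prod_roots, hlc]
  -- By parity `p - q` is `±(p + q)` at `-x`. As the coefficients are real, conjugating the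
  -- factorization at `-x̄` turns each factor `x - r` into `x + r̄`.
  have hneg : ∀ x : ℂ, aeval x p - aeval x q =
      p.coeff (n + 1) * (f.roots.map fun r => x + starRingEnd ℂ r).prod := fun x => by
    have h1 : aeval x p - aeval x q =
        (-1) ^ (n + 1) * starRingEnd ℂ (aeval (-starRingEnd ℂ x) (p + q)) := by
      rw [← aeval_conj, map_neg, Complex.conj_conj, map_add, aeval_neg_of_hasParity hp,
        aeval_neg_of_hasParity hq]
      have : ((-1 : ℂ) ^ n) * (-1) ^ n = 1 := by rw [← mul_pow]; simp
      rw [pow_succ]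
      linear_combination (-(aeval x p) + aeval x q) * this
    rw [h1, hprod, map_mul, Complex.conj_ofReal, map_multiset_prod, Multiset.map_map, ← hcard,
      mul_left_comm,
      ← Multiset.card_map (starRingEnd ℂ ∘ fun r => -starRingEnd ℂ x - r) f.roots,
      ← Multiset.prod_map_neg, Multiset.map_map]
    congr 2
    refine Multiset.map_congr rfl fun r _ => ?_
    simp [add_comm]
  -- Vieta: `p` contributes nothing in degree `n`, so `q.coeff n` is the subleading coefficient of
  -- `p + q`.
  have hsum : q.coeff n = p.coeff (n + 1) * (f.roots.map fun r => -r.re).sum := by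
    have h1 : f.nextCoeff = (q.coeff n : ℂ) := by
      have : p.coeff n = 0 := by
        by_contra h
        obtain ⟨j, hj⟩ := hp n h
        omega
      rw [nextCoeff_of_natDegree_pos (by omega), hdegf, hf, coeff_map, coeff_add, Nat.add_sub_cancel,
        this]
      simp
    have h2 := hsp.nextCoeff_eq_neg_sum_roots_mul_leadingCoeff
    rw [h1, hlc] at h2
    have h3 := congrArg Complex.re h2
    have h4 : (f.roots.map fun r => -r.re).sum = -(f.roots.sum).re := by
      rw [← Complex.neg_re, ← Multiset.sum_map_neg', ← Complex.coe_reAddGroupHom,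
        map_multiset_sum, Multiset.map_map]
      rfl
    rw [h4]
    simpa [mul_comm] using h3
  have hpos : 0 < (f.roots.map fun r => -r.re).sum := by
    obtain ⟨r, hr⟩ : ∃ r, r ∈ f.roots := Multiset.exists_mem_of_ne_zero (by
      intro h; rw [h] at hcard; simp at hcard)
    obtain ⟨s, hs⟩ := Multiset.exists_cons_of_mem hr
    have h1 := hroots r hr
    have h2 := (julia_inequality 0 le_rfl s fun t ht =>
      hroots t (by rw [hs]; exact Multiset.mem_cons_of_mem ht)).1
    rw [hs, Multiset.map_cons, Multiset.sum_cons]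
    linarith
  refine ⟨by rw [hsum]; positivity, fun x hx => ?_⟩
  have hJ := (julia_inequality x hx f.roots hroots).2.2
  have h4 := four_mul_re_mul_conj (aeval x p) (aeval x q)
  have h5 := hprod x
  rw [map_add] at h5
  have h6 : 2 * aeval x q = p.coeff (n + 1) * ((f.roots.map fun r => x - r).prod -
      (f.roots.map fun r => x + starRingEnd ℂ r).prod) := by
    linear_combination h5 - hneg x
  have h7 : 4 * ‖aeval x q‖ ^ 2 = p.coeff (n + 1) ^ 2 * ‖(f.roots.map fun r => x - r).prod -
      (f.roots.map fun r => x + starRingEnd ℂ r).prod‖ ^ 2 := by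
    have := congrArg (fun w : ℂ => ‖w‖ ^ 2) h6
    simp only [norm_mul, mul_pow, Complex.norm_real, Real.norm_eq_abs, sq_abs] at this
    norm_num at this
    exact this
  rw [h5, hneg, norm_mul, norm_mul, mul_pow, mul_pow, Complex.norm_real, Real.norm_eq_abs, sq_abs]
    at h4
  rw [hsum]
  have h8 := mul_le_mul_of_nonneg_left hJ (pow_pos hlead 3).le
  generalize (f.roots.map fun r => x - r).prod = F at *
  generalize (f.roots.map fun r => x + starRingEnd ℂ r).prod = G at *
  generalize (f.roots.map fun r => -r.re).sum = A at *
  generalize p.coeff (n + 1) = c at *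
  -- Up to the factor `c ^ 3 / 4`, the two sides of the claim are those of Julia's inequality.
  have e1 : 4 * (c * x.re * ‖aeval x q‖ ^ 2) = c ^ 3 * (x.re * ‖F - G‖ ^ 2) := by
    linear_combination c * x.re * h7
  have e2 : 4 * (c * A * (aeval x p * starRingEnd ℂ (aeval x q)).re) =
      c ^ 3 * (A * (‖F‖ ^ 2 - ‖G‖ ^ 2)) := by
    linear_combination c * A * h4
  linarith

/-- At a zero of the new sum, `p = (c x - 1) q`, so `Re (p q̄) = (c Re x - 1)|q|²`. The lower bound
`c Re x |q|²` forces `q = 0`, then `p = 0`. -/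
theorem isStable_step (hp : p.HasParity (n + 1)) (hq : q.HasParity n)
    (hlead : 0 < p.coeff (n + 1)) (hst : (p + q).IsStable) :
    (q + (p - C (p.coeff (n + 1) / q.coeff n) * X * q)).IsStable := by
  obtain ⟨hpos, hre⟩ := re_part_quotient_of_isStable hp hq hlead hst
  intro x hx h
  have h1 : aeval x (p - C (p.coeff (n + 1) / q.coeff n) * X * q) =
      aeval x p - (p.coeff (n + 1) / q.coeff n : ℝ) * x * aeval x q := by
    simp
  have key : aeval x q = 0 := by
    have h2 := hre x hx
    rw [map_add, h1] at h
    have h3 : aeval x p = (p.coeff (n + 1) / q.coeff n : ℝ) * x * aeval x q - aeval x q := by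
      linear_combination h
    rw [h3, sub_mul, mul_assoc _ (aeval x q), Complex.mul_conj, Complex.sub_re, Complex.ofReal_re,
      Complex.re_mul_ofReal, Complex.re_ofReal_mul, ← Complex.sq_norm] at h2
    have h4 : q.coeff n * ((p.coeff (n + 1) / q.coeff n) * x.re * ‖aeval x q‖ ^ 2
        - ‖aeval x q‖ ^ 2) =
        p.coeff (n + 1) * x.re * ‖aeval x q‖ ^ 2 - q.coeff n * ‖aeval x q‖ ^ 2 := by
      field_simp
    rw [h4] at h2
    have h5 : ‖aeval x q‖ ^ 2 ≤ 0 := by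
      by_contra! h5
      nlinarith [mul_pos hpos h5]
    simpa using h5
  refine hst x hx ?_
  rw [map_add, h1, key] at h
  rw [map_add, key]
  simpa using h

/-- With `r = p - c X q`, a zero of `p + q` has `r = -(1 + c x) q`, so `Re (q r̄) ≥ 0` forces `q =
0`, then `r = 0`. -/
theorem isStable_of_step {c : ℝ} (hc : 0 ≤ c)
    (hre : ∀ x : ℂ, 0 ≤ x.re →
      0 ≤ (aeval x q * starRingEnd ℂ (aeval x (p - C c * X * q))).re)
    (hst : (q + (p - C c * X * q)).IsStable) : (p + q).IsStable := by
  intro x hx h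
  have h1 : aeval x (p - C c * X * q) = aeval x p - c * x * aeval x q := by
    simp
  have key : aeval x q = 0 := by
    have h2 := hre x hx
    rw [map_add] at h
    have h3 : aeval x (p - C c * X * q) = - ((1 + c * x) * aeval x q) := by
      linear_combination h1 + h
    have h4 : (aeval x q * starRingEnd ℂ (aeval x (p - C c * X * q))).re =
        -((1 + c * x.re) * ‖aeval x q‖ ^ 2) := by
      rw [h3, map_neg, map_mul, mul_neg, mul_left_comm, Complex.mul_conj, Complex.neg_re,
        Complex.re_mul_ofReal, ← Complex.sq_norm]
      simp
    rw [h4] at h2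
    have h5 : ‖aeval x q‖ ^ 2 ≤ 0 := by nlinarith [mul_nonneg hc hx, sq_nonneg ‖aeval x q‖]
    simpa using h5
  refine hst x hx ?_
  rw [map_add, key] at h
  rw [map_add, h1, key]
  simpa using h

end Stable

end RouthHurwitz

/-! ## Routh tables over a field -/

section Routh

variable {F : Type*} [Field F]

/-- The Routh table with first two rows `a` and `b`. -/
def routh (a b : ℕ → F) : ℕ → ℕ → F
  | 0, j => a j
  | 1, j => b j
  | i + 2, j =>
    (routh a b i (j + 1) * routh a b (i + 1) 0 - routh a b i 0 * routh a b (i + 1) (j + 1)) /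
      routh a b (i + 1) 0

/-- The normalizing factor of the `i`-th row of the Routh table. -/
def routhHat (a b : ℕ → F) : ℕ → F
  | 0 => 1
  | 1 => routh a b 0 0 * 1
  | i + 2 => routh a b (i + 1) 0 * routhHat a b (i + 1) * routhHat a b i

open Classical in
/-- The rows of the Routh table multiplied by their normalizing factors, computed without
divisions. -/
noncomputable def routhNum {R : Type*} [CommRing R] (a b : ℕ → R) : ℕ → ℕ → R
  | 0, j => a j
  | 1, j => a 0 * b j
  | i + 2, j =>
    if routhNum a b (i + 1) 0 = 0 then 0
    else routhNum a b i (j + 1) * routhNum a b (i + 1) 0 -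
      routhNum a b i 0 * routhNum a b (i + 1) (j + 1)

theorem map_routh {E : Type*} [Field E] (f : F →+* E) (a b : ℕ → F) (i j : ℕ) :
    routh (fun k => f (a k)) (fun k => f (b k)) i j = f (routh a b i j) := by
  induction i using Nat.strong_induction_on generalizing j with
  | _ i ih =>
    match i with
    | 0 => rfl
    | 1 => rfl
    | i + 2 => simp [routh, ih i (by omega), ih (i + 1) (by omega)]

theorem map_routhHat {E : Type*} [Field E] (f : F →+* E) (a b : ℕ → F) (i : ℕ) :
    routhHat (fun k => f (a k)) (fun k => f (b k)) i = f (routhHat a b i) := by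
  induction i using Nat.strong_induction_on with
  | _ i ih =>
    match i with
    | 0 => simp [routhHat]
    | 1 => simp [routhHat, map_routh]
    | i + 2 => simp [routhHat, map_routh, ih i (by omega), ih (i + 1) (by omega)]

/-- The factor of row `i + 2` contains the pivot of row `i + 1` and both previous factors, so it
clears the division and normalizes both products in the numerator. The hypothesis makes symbolic and
numerical zero tests agree; the lemma serves both the embedding in the fraction field and evaluation
at a point. -/
theorem map_routhNum_eq {R : Type*} [CommRing R] (f : R →+* F) (a b : ℕ → R) (i j : ℕ)
    (h : ∀ k < i, f (routhNum a b k 0) = 0 → routhNum a b k 0 = 0) :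
    f (routhNum a b i j) = routhHat (fun k => f (a k)) (fun k => f (b k)) i *
      routh (fun k => f (a k)) (fun k => f (b k)) i j := by
  induction i using Nat.strong_induction_on generalizing j with
  | _ i ih =>
    match i with
    | 0 => simp [routhNum, routhHat, routh]
    | 1 => simp [routhNum, routhHat, routh]
    | i + 2 =>
      have h0 := fun j => ih i (by omega) j fun k hk => h k (by omega)
      have h1 := fun j => ih (i + 1) (by omega) j fun k hk => h k (by omega)
      rw [routhNum, routhHat, routh]
      split_ifs with hz
      · have h2 := h1 0
        rw [hz, map_zero] at h2
        -- Either vanishing factor also divides the normalizing factor of row `i + 2`.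
        rcases mul_eq_zero.1 h2.symm with h3 | h3 <;> simp [h3]
      · have h2 : routh (fun k => f (a k)) (fun k => f (b k)) (i + 1) 0 ≠ 0 := fun h3 =>
          hz (h (i + 1) (by omega) (by rw [h1, h3, mul_zero]))
        rw [map_sub, map_mul, map_mul, h0, h0, h1, h1]
        field_simp

theorem map_routhNum_self {R : Type*} [CommRing R] (f : R →+* R) (a b : ℕ → R)
    (ha : ∀ j, f (a j) = a j) (hb : ∀ j, f (b j) = b j) (i j : ℕ) :
    f (routhNum a b i j) = routhNum a b i j := by
  induction i using Nat.strong_induction_on generalizing j with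
  | _ i ih =>
    match i with
    | 0 => exact ha j
    | 1 => simp [routhNum, ha, hb]
    | i + 2 =>
      rw [routhNum]
      split_ifs
      · simp
      · simp [ih i (by omega), ih (i + 1) (by omega)]

theorem routhHat_pos {a b : ℕ → ℝ} (i : ℕ) (h : ∀ k < i, 0 < routh a b k 0) :
    0 < routhHat a b i := by
  induction i using Nat.strong_induction_on with
  | _ i ih =>
    match i with
    | 0 => simp [routhHat]
    | 1 => simpa [routhHat] using h 0 (by omega)
    | i + 2 =>
      exact mul_pos (mul_pos (h (i + 1) (by omega)) (ih (i + 1) (by omega) fun k hk => h k (by omega)))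
        (ih i (by omega) fun k hk => h k (by omega))

/-- Positivity of the first column of the Routh table can be read off from the normalized
entries. -/
theorem forall_routh_pos_iff (a b : ℕ → ℝ) (n : ℕ) :
    (∀ i ≤ n, 0 < routh a b i 0) ↔ ∀ i ≤ n, 0 < routhHat a b i * routh a b i 0 := by
  refine ⟨fun h i hi => mul_pos (routhHat_pos i fun k hk => h k (by omega)) (h i hi),
    fun h i => ?_⟩
  induction i using Nat.strong_induction_on with
  | _ i ih =>
    intro hi
    exact (mul_pos_iff_of_pos_left (routhHat_pos i fun k hk => ih k hk (by omega))).1 (h i hi)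

end Routh

/-! ### The Routh–Hurwitz criterion. -/

namespace RouthHurwitz

open Polynomial

/-- The polynomials whose coefficients are the rows of a Routh table with first rows given by the
coefficients of `p` and `q`. -/
noncomputable def rowPoly (a b : ℕ → ℝ) (p q : ℝ[X]) : ℕ → ℝ[X]
  | 0 => p
  | 1 => q
  | i + 2 => rowPoly a b p q i -
      C (routh a b i 0 / routh a b (i + 1) 0) * X * rowPoly a b p q (i + 1)

variable {a b : ℕ → ℝ} {p q : ℝ[X]} {n : ℕ}

theorem routh_eq_zero (ha : ∀ j, n < 2 * j → a j = 0) (hb : ∀ j, n < 2 * j + 1 → b j = 0)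
    (i j : ℕ) (h : n < 2 * j + i) : routh a b i j = 0 := by
  induction i using Nat.strong_induction_on generalizing j with
  | _ i ih =>
    match i with
    | 0 => exact ha j h
    | 1 => exact hb j h
    | i + 2 => rw [routh, ih i (by omega) _ (by omega), ih (i + 1) (by omega) (j + 1) (by omega)]; simp

/-- The coefficients of the row polynomials are the entries of the table. -/
theorem rowPoly_coeff (ha : ∀ j, n < 2 * j → a j = 0) (hb : ∀ j, n < 2 * j + 1 → b j = 0)
    (hp : p.HasParity n) (hpa : ∀ k j, k + 2 * j = n → p.coeff k = a j)
    (hq : ∀ k, q.coeff k ≠ 0 → ∃ j, k + 2 * j + 1 = n)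
    (hqb : ∀ k j, k + 2 * j + 1 = n → q.coeff k = b j)
    (i : ℕ) (hi : ∀ m < i, 0 < m → routh a b m 0 ≠ 0) :
    (∀ k, (rowPoly a b p q i).coeff k ≠ 0 → ∃ j, k + 2 * j + i = n) ∧
      ∀ k j, k + 2 * j + i = n → (rowPoly a b p q i).coeff k = routh a b i j := by
  induction i using Nat.strong_induction_on with
  | _ i ih =>
    match i with
    | 0 => exact ⟨hp, hpa⟩
    | 1 => exact ⟨hq, hqb⟩
    | i + 2 =>
      obtain ⟨h0, h0'⟩ := ih i (by omega) fun m hm => hi m (by omega)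
      obtain ⟨h1, h1'⟩ := ih (i + 1) (by omega) fun m hm => hi m (by omega)
      have hne := hi (i + 1) (by omega) (by omega)
      -- The pivot quotient is chosen to cancel the leading term. For `k = 0` row `i + 1` lies
      -- beyond the table, so its pivot cannot be nonzero.
      have hlast : ∀ k, k + i = n → (rowPoly a b p q (i + 2)).coeff k = 0 := by
        intro k hk
        rw [rowPoly, mul_assoc, coeff_sub, coeff_C_mul, h0' k 0 (by omega)]
        cases k with
        | zero =>
          exact absurd (routh_eq_zero ha hb (i + 1) 0 (by omega)) hne
        | succ k =>
          rw [coeff_X_mul, h1' k 0 (by omega)]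
          field_simp
          simp
      constructor
      · intro k hk
        suffices ∃ j, k + 2 * j + i = n by
          obtain ⟨j, hj⟩ := this
          cases j with
          | zero => exact absurd (hlast k (by omega)) hk
          | succ j => exact ⟨j, by omega⟩
        by_cases h : (rowPoly a b p q i).coeff k = 0
        · rw [rowPoly, mul_assoc, coeff_sub, coeff_C_mul, h] at hk
          cases k with
          | zero => simp at hk
          | succ k =>
            rw [coeff_X_mul] at hk
            obtain ⟨j, hj⟩ := h1 k (by intro h'; simp [h'] at hk)
            exact ⟨j, by omega⟩
        · exact h0 k h
      · intro k j hk
        rw [rowPoly, mul_assoc, coeff_sub, coeff_C_mul, h0' k (j + 1) (by omega), routh]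
        cases k with
        | zero =>
          rw [routh_eq_zero ha hb (i + 1) (j + 1) (by omega)]
          field_simp
          simp
        | succ k =>
          rw [coeff_X_mul, h1' k (j + 1) (by omega)]
          field_simp

/-- The Routh–Hurwitz criterion for a polynomial of degree `n`, split into parts of opposite
parities whose coefficients are `a` and `b`. -/
theorem isStable_iff_routh_pos (ha : ∀ j, n < 2 * j → a j = 0)
    (hb : ∀ j, n < 2 * j + 1 → b j = 0)
    (hp : p.HasParity n) (hpa : ∀ k j, k + 2 * j = n → p.coeff k = a j)
    (hq : ∀ k, q.coeff k ≠ 0 → ∃ j, k + 2 * j + 1 = n)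
    (hqb : ∀ k j, k + 2 * j + 1 = n → q.coeff k = b j) (hlead : 0 < a 0) :
    (p + q).IsStable ↔ ∀ i ≤ n, 0 < routh a b i 0 := by
  have hrow := rowPoly_coeff ha hb hp hpa hq hqb
  have hpar : ∀ i d, d + i = n → (∀ m < i, 0 < m → routh a b m 0 ≠ 0) →
      (rowPoly a b p q i).HasParity d ∧ (rowPoly a b p q i).coeff d = routh a b i 0 := by
    intro i d hd hi
    refine ⟨fun k hk => ?_, (hrow i hi).2 d 0 (by omega)⟩
    obtain ⟨j, hj⟩ := (hrow i hi).1 k hk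
    exact ⟨j, by omega⟩
  have hend : (∀ m < n + 1, 0 < m → routh a b m 0 ≠ 0) → rowPoly a b p q (n + 1) = 0 := by
    intro hm
    ext k
    by_contra h
    obtain ⟨j, hj⟩ := (hrow (n + 1) hm).1 k h
    omega
  constructor
  · intro hst i hi
    suffices ∀ i ≤ n, (∀ m ≤ i, 0 < routh a b m 0) ∧
        (rowPoly a b p q i + rowPoly a b p q (i + 1)).IsStable from (this i hi).1 i le_rfl
    intro i
    induction i with
    | zero => exact fun _ => ⟨fun m hm => by rwa [Nat.le_zero.1 hm], hst⟩
    | succ i ih =>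
      intro hi
      obtain ⟨h1, h2⟩ := ih (by omega)
      obtain ⟨d, rfl⟩ := Nat.exists_eq_add_of_le' hi
      have hne : ∀ m < i + 1, 0 < m → routh a b m 0 ≠ 0 := fun m hm _ => (h1 m (by omega)).ne'
      obtain ⟨hP, hPl⟩ := hpar i (d + 1) (by omega) fun m hm => hne m (by omega)
      obtain ⟨hQ, hQl⟩ := hpar (i + 1) d (by omega) hne
      have hPpos : 0 < (rowPoly a b p q i).coeff (d + 1) := by rw [hPl]; exact h1 i le_rfl
      have h3 := (re_part_quotient_of_isStable hP hQ hPpos h2).1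
      have h4 := isStable_step hP hQ hPpos h2
      rw [hPl, hQl] at h4
      rw [hQl] at h3
      refine ⟨fun m hm => ?_, h4⟩
      rcases Nat.lt_or_ge m (i + 1) with hm' | hm'
      · exact h1 m (by omega)
      · rwa [le_antisymm hm hm']
  · intro hpos
    have hne : ∀ m < n + 1, 0 < m → routh a b m 0 ≠ 0 := fun m hm _ => (hpos m (by omega)).ne'
    -- Climb from the last row, a positive constant. Stability of each lower pair provides the sign
    -- of the real part that `isStable_of_step` needs.
    suffices ∀ d i, d + i = n → (rowPoly a b p q i + rowPoly a b p q (i + 1)).IsStable from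
      this n 0 rfl
    intro d
    induction d with
    | zero =>
      intro i hi
      obtain rfl : i = n := by omega
      rw [hend hne, add_zero]
      obtain ⟨hP, hPl⟩ := hpar i 0 hi fun m hm => hne m (by omega)
      rw [eq_C_of_natDegree_le_zero (natDegree_le_of_hasParity hP), hPl]
      intro x _
      simpa using (hpos i le_rfl).ne'
    | succ d ih =>
      intro i hi
      have h1 := ih (i + 1) (by omega)
      have hposi := hpos i (by omega)
      have hposi' := hpos (i + 1) (by omega)
      refine isStable_of_step (c := routh a b i 0 / routh a b (i + 1) 0) (by positivity) ?_ h1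
      intro x hx
      change 0 ≤ (aeval x (rowPoly a b p q (i + 1)) *
        starRingEnd ℂ (aeval x (rowPoly a b p q (i + 2)))).re
      cases d with
      | zero =>
        obtain rfl : i + 1 = n := by omega
        rw [hend hne]
        simp
      | succ d =>
        obtain ⟨hQ, hQl⟩ := hpar (i + 1) (d + 1) (by omega) fun m hm => hne m (by omega)
        obtain ⟨hR, hRl⟩ := hpar (i + 2) d (by omega) fun m hm => hne m (by omega)
        obtain ⟨h2, h3⟩ := re_part_quotient_of_isStable hQ hR (by rwa [hQl]) h1
        have h4 := h3 x hx
        rw [hQl] at h4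
        exact nonneg_of_mul_nonneg_right (le_trans (by positivity) h4) h2

end RouthHurwitz

/-! ## Well-posedness and the symbol of `Δ - A_SS` -/

section WellPosed

theorem lp_two_norm_sq {D E : Type*} [NormedAddCommGroup E] (x : lp (fun _ : D => E) 2) :
    HasSum (fun k => ‖x k‖ ^ 2) (‖x‖ ^ 2) := by
  have h := lp.hasSum_norm (p := 2) (by norm_num) x
  simpa using h

/-- A unimodular function on `ℤ / n` which is multiplied by `u` under the shift. -/
theorem exists_character {n : ℕ} {u : ℂ} (hu : ‖u‖ = 1) (hun : u ^ n = 1) :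
    ∃ χ : ZMod n → ℂ, (∀ k, ‖χ k‖ = 1) ∧ ∀ k, χ (k + 1) = u * χ k := by
  have hu0 : u ≠ 0 := by rintro rfl; simp at hu
  cases n with
  | zero =>
    exact ⟨fun k : ℤ => u ^ k, fun k => (norm_zpow u k).trans (by rw [hu]; exact one_zpow k), fun k => by
      rw [mul_comm]; exact zpow_add_one₀ hu0 k⟩
  | succ n =>
    refine ⟨fun k => u ^ k.val, fun k => by simp [hu], fun k => ?_⟩
    change u ^ (k + 1).val = u * u ^ k.val
    rw [ZMod.val_add, ← pow_eq_pow_mod _ hun, pow_add, mul_comm]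
    rcases Nat.eq_zero_or_pos n with rfl | hn
    · have : u = 1 := by simpa using hun
      simp [this]
    · have : Fact (1 < n + 1) := ⟨by omega⟩
      rw [ZMod.val_one, pow_one]

/-- A positive square-summable weight on `ℤ / n` which varies slowly. -/
theorem exists_weight (n : ℕ) {ε : ℝ} (hε : 0 < ε) :
    ∃ w : ZMod n → ℝ, (∀ k, 0 < w k) ∧ (Summable fun k => w k ^ 2) ∧
      ∀ k, |w (k + 1) - w k| ≤ ε * w k ∧ |w (k - 1) - w k| ≤ ε * w k := by
  cases n with
  | succ n =>
    have : Fintype (ZMod (n + 1)) := ZMod.fintype (n + 1)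
    exact ⟨fun _ => 1, fun _ => one_pos, Summable.of_finite, fun k => by simp [hε.le]⟩
  | zero =>
    -- For the weight `r ^ |k|`, neighbouring values have ratio `r` or `r⁻¹ = 1 + ε`, both within
    -- `ε` of `1`.
    set r : ℝ := (1 + ε)⁻¹ with hr
    have hr0 : 0 < r := by positivity
    have hr1 : r < 1 := inv_lt_one_of_one_lt₀ (by linarith)
    have hre : r * (1 + ε) = 1 := by rw [hr]; field_simp
    have step : ∀ a b : ℕ, (a = b + 1 ∨ b = a + 1) → |r ^ a - r ^ b| ≤ ε * r ^ b := by
      rintro a b (rfl | rfl)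
      · have h := pow_pos hr0 b
        rw [pow_succ, abs_le]
        constructor <;> nlinarith [mul_pos h hε]
      · have h := pow_pos hr0 a
        rw [pow_succ, abs_le]
        constructor <;> nlinarith [mul_pos h hε, mul_pos h hr0]
    refine ⟨fun k : ℤ => r ^ k.natAbs, fun k => by positivity, ?_, fun k => ⟨?_, ?_⟩⟩
    · have h1 : Summable fun k : ℕ => (r ^ k) ^ 2 := by
        simp_rw [← pow_mul, mul_comm _ 2, pow_mul]
        exact summable_geometric_of_lt_one (by positivity) (by nlinarith)
      exact Summable.of_nat_of_neg (f := fun k : ℤ => (r ^ k.natAbs) ^ 2) (by simpa using h1)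
        (by simpa using h1)
    · refine step (Int.natAbs (Int.add k 1)) (Int.natAbs k) ?_
      change Int.natAbs (@HAdd.hAdd ℤ ℤ ℤ _ k 1) = _ ∨ _ = Int.natAbs (@HAdd.hAdd ℤ ℤ ℤ _ k 1) + 1
      omega
    · refine step (Int.natAbs (Int.sub k 1)) (Int.natAbs k) ?_
      change Int.natAbs (@HSub.hSub ℤ ℤ ℤ _ k 1) = _ ∨ _ = Int.natAbs (@HSub.hSub ℤ ℤ ℤ _ k 1) + 1
      omega

/-- A finite set lies in a box, over which the sum factors. -/
theorem summable_pi_prod {ι : Type*} [Fintype ι] [DecidableEq ι] {α : ι → Type*}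
    {f : ∀ i, α i → ℝ} (h0 : ∀ i a, 0 ≤ f i a) (hf : ∀ i, Summable (f i)) :
    Summable fun k : ∀ i, α i => ∏ i, f i (k i) := by
  classical
  refine summable_of_sum_le (c := ∏ i, ∑' a, f i a)
    (fun k => Finset.prod_nonneg fun i _ => h0 i _) fun s => ?_
  calc ∑ k ∈ s, ∏ i, f i (k i)
      ≤ ∑ k ∈ Fintype.piFinset fun i => s.image fun k => k i, ∏ i, f i (k i) := by
        refine Finset.sum_le_sum_of_subset_of_nonneg (fun k hk => ?_)
          fun k _ _ => Finset.prod_nonneg fun i _ => h0 i _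
        exact Fintype.mem_piFinset.2 fun i => Finset.mem_image_of_mem _ hk
    _ = ∏ i, ∑ a ∈ s.image fun k => k i, f i a := (Finset.prod_univ_sum _ _).symm
    _ ≤ _ := Finset.prod_le_prod (fun i _ => Finset.sum_nonneg fun a _ => h0 i a)
        fun i _ => (hf i).sum_le_tsum _ fun a _ => h0 i a

theorem prod_add_single {ι M : Type*} [Fintype ι] [DecidableEq ι] [CommMonoid M] {α : ι → Type*}
    [∀ i, AddCommGroup (α i)] (g : ∀ i, α i → M) (k : ∀ i, α i) (i : ι) (t : α i) :
    ∏ j, g j ((k + Pi.single i t) j) = g i (k i + t) * ∏ j ∈ Finset.univ.erase i, g j (k j) := by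
  rw [← Finset.mul_prod_erase _ _ (Finset.mem_univ i)]
  congr 1
  · simp
  · refine Finset.prod_congr rfl fun j hj => ?_
    rw [Pi.add_apply, Pi.single_eq_of_ne (Finset.ne_of_mem_erase hj), add_zero]

variable {L : ℕ} {l : ℕ} {N : Fin L → ℕ} {np nm : Fin L → ℕ}

/-- The plane wave `∏ z_i ^ k_i`; it descends to the periodic directions because `z_i` is an `N
i`-th root of unity there. -/
theorem exists_domain_character {z : Fin L → ℂ} (hz : z ∈ torusG l N) :
    ∃ χ : SpatialDomain l N → ℂ, (∀ k, ‖χ k‖ = 1) ∧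
      ∀ k (j : IntIdx np nm), χ (k + shiftStep l N j) = deltaEntry z j * χ k := by
  have hper : ∀ i, z i ^ spatialPeriod l N i = 1 := fun i => by
    unfold spatialPeriod
    split_ifs with h
    · simp
    · exact hz.2 i (not_lt.1 h)
  choose χ hχ hstep using fun i => exists_character (hz.1 i) (hper i)
  have hz0 : ∀ i, z i ≠ 0 := fun i h => by simpa [h] using hz.1 i
  refine ⟨fun k => ∏ i, χ i (k i), fun k => by simp [norm_prod, hχ], fun k j => ?_⟩
  obtain ⟨i, j | j⟩ := j
  · simp only [shiftStep, deltaEntry]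
    rw [prod_add_single, hstep, mul_assoc, Finset.mul_prod_erase _ (fun i => χ i (k i))
      (Finset.mem_univ i)]
  · simp only [shiftStep, deltaEntry]
    rw [← Pi.single_neg, prod_add_single]
    have h1 : χ i (k i + -1) = (z i)⁻¹ * χ i (k i) := by
      have := hstep i (k i + -1)
      rw [neg_add_cancel_right] at this
      rw [this, inv_mul_cancel_left₀ (hz0 i)]
    rw [h1, mul_assoc, Finset.mul_prod_erase _ (fun i => χ i (k i)) (Finset.mem_univ i)]

theorem exists_domain_weight {ε : ℝ} (hε : 0 < ε) :
    ∃ w : SpatialDomain l N → ℝ, (∀ k, 0 < w k) ∧ (Summable fun k => w k ^ 2) ∧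
      ∀ k (j : IntIdx np nm), |w (k + shiftStep l N j) - w k| ≤ ε * w k := by
  choose w hpos hsum hstep using fun i => exists_weight (spatialPeriod l N i) hε
  refine ⟨fun k => ∏ i, w i (k i), fun k => Finset.prod_pos fun i _ => hpos i _, ?_, ?_⟩
  · simp_rw [← Finset.prod_pow]
    exact summable_pi_prod (f := fun i a => w i a ^ 2) (fun i a => sq_nonneg _) hsum
  · intro k j
    have key : ∀ (i : Fin L) (t : ZMod (spatialPeriod l N i)),
        |w i (k i + t) - w i (k i)| ≤ ε * w i (k i) →
        |∏ j, w j ((k + Pi.single i t : SpatialDomain l N) j) - ∏ i, w i (k i)| ≤ ε * ∏ i, w i (k i) := by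
      intro i t ht
      have hP : 0 ≤ ∏ j ∈ Finset.univ.erase i, w j (k j) :=
        Finset.prod_nonneg fun j _ => (hpos j _).le
      rw [prod_add_single, ← Finset.mul_prod_erase _ (fun i => w i (k i)) (Finset.mem_univ i),
        ← sub_mul, abs_mul, abs_of_nonneg hP, ← mul_assoc]
      exact mul_le_mul_of_nonneg_right ht hP
    obtain ⟨i, j | j⟩ := j
    · exact key i 1 (hstep i (k i)).1
    · have := key i (-1) (by simpa [sub_eq_add_neg] using (hstep i (k i)).2)
      simpa only [shiftStep, ← Pi.single_neg] using this

section ModulatedSignal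

variable {D ι : Type} [Fintype ι] {w : D → ℝ}

theorem memlp_modulated (hw : Summable fun k => w k ^ 2) {χ : D → ℂ} (hχ : ∀ k, ‖χ k‖ = 1)
    (v : ι → ℂ) :
    Memℓp (fun k => (WithLp.toLp 2 fun j => w k * (χ k * v j).re : EuclideanSpace ℝ ι)) 2 := by
  refine memℓp_gen (Summable.of_nonneg_of_le (fun k => by positivity) (fun k => ?_)
    (hw.mul_right (∑ j, ‖v j‖ ^ 2)))
  simp only [ENNReal.toReal_ofNat, Real.rpow_two]
  rw [EuclideanSpace.real_norm_sq_eq, Finset.mul_sum]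
  refine Finset.sum_le_sum fun j _ => ?_
  rw [mul_pow]
  refine mul_le_mul_of_nonneg_left ?_ (sq_nonneg _)
  rw [← sq_abs]
  refine pow_le_pow_left₀ (abs_nonneg _) ((Complex.abs_re_le_norm _).trans_eq ?_) 2
  rw [norm_mul, hχ, one_mul]

/-- The signal `w(k) Re (χ(k) v)`. -/
noncomputable def modulated (hw : Summable fun k => w k ^ 2) {χ : D → ℂ} (hχ : ∀ k, ‖χ k‖ = 1)
    (v : ι → ℂ) : EllTwo D ι :=
  ⟨fun k => WithLp.toLp 2 fun j => w k * (χ k * v j).re, memlp_modulated hw hχ v⟩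

theorem modulated_apply (hw : Summable fun k => w k ^ 2) {χ : D → ℂ} (hχ : ∀ k, ‖χ k‖ = 1)
    (v : ι → ℂ) (k : D) (j : ι) : modulated hw hχ v k j = w k * (χ k * v j).re := rfl

/-- Signals are real, and the real part of a plane wave may be small or zero. The vector `I • v`
contributes the imaginary part, and together they recover `‖v‖²` at every site. -/
theorem norm_sq_modulated_add (hw : Summable fun k => w k ^ 2) {χ : D → ℂ}
    (hχ : ∀ k, ‖χ k‖ = 1) (v : ι → ℂ) :
    ‖modulated hw hχ v‖ ^ 2 + ‖modulated hw hχ (Complex.I • v)‖ ^ 2 =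
      (∑' k, w k ^ 2) * ∑ j, ‖v j‖ ^ 2 := by
  refine ((lp_two_norm_sq _).add (lp_two_norm_sq _)).unique ?_
  refine (hw.hasSum.mul_right (∑ j, ‖v j‖ ^ 2)).congr_fun fun k => ?_
  rw [EuclideanSpace.real_norm_sq_eq, EuclideanSpace.real_norm_sq_eq, ← Finset.sum_add_distrib,
    Finset.mul_sum]
  refine Finset.sum_congr rfl fun j _ => ?_
  rw [modulated_apply, modulated_apply]
  have h1 : ‖v j‖ ^ 2 = (χ k * v j).re ^ 2 + (χ k * v j).im ^ 2 := by
    rw [← one_mul ‖v j‖, ← hχ k, ← norm_mul, Complex.sq_norm, Complex.normSq_apply]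
    ring
  have h2 : (χ k * (Complex.I • v) j).re = -(χ k * v j).im := by
    rw [Pi.smul_apply, smul_eq_mul, mul_left_comm, Complex.I_mul_re]
  rw [h1, h2]
  ring

end ModulatedSignal

theorem SIS.det_ne_zero_of_wellPosed {n₀ : ℕ} (S : SIS L n₀ np nm) (hwp : S.WellPosed l N)
    {z : Fin L → ℂ} (hz : z ∈ torusG l N) :
    (Matrix.diagonal (deltaEntry z) - S.ASS.map Complex.ofReal :
      Matrix (IntIdx np nm) (IntIdx np nm) ℂ).det ≠ 0 := by
  intro hdet
  obtain ⟨v, hv0, hv⟩ := Matrix.exists_mulVec_eq_zero_iff.2 hdet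
  obtain ⟨χ, hχ, hχs⟩ := exists_domain_character (np := np) (nm := nm) hz
  obtain ⟨T, hT⟩ := hwp
  set C := ‖(T⁻¹).val‖ with hC
  have hbound : ∀ x, ‖x‖ ≤ C * ‖T.val x‖ := fun x => by
    have h1 : (T⁻¹).val (T.val x) = x := by
      rw [← mul_apply_eq_comp, Units.inv_mul]; rfl
    conv_lhs => rw [← h1]
    exact ContinuousLinearMap.le_opNorm _ _
  have hC0 : 0 ≤ C := norm_nonneg _
  -- Ensures `C * ε ≤ 1 / 2`, so the bounds for `v` and `I • v` add up to at most half of their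
  -- exact total.
  set ε := (2 * (C + 1))⁻¹ with hε
  have hε0 : 0 < ε := by positivity
  obtain ⟨w, hwpos, hw, hws⟩ := exists_domain_weight (l := l) (N := N) (np := np) (nm := nm) hε0
  have hsmall : ∀ u : IntIdx np nm → ℂ,
      (Matrix.diagonal (deltaEntry z) - S.ASS.map Complex.ofReal) *ᵥ u = 0 →
      ‖T.val (modulated hw hχ u)‖ ^ 2 ≤ ε ^ 2 * ((∑' k, w k ^ 2) * ∑ j, ‖u j‖ ^ 2) := by
    intro u hu
    refine hasSum_le (fun k => ?_) (lp_two_norm_sq _)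
      ((hw.hasSum.mul_right (∑ j, ‖u j‖ ^ 2)).mul_left (ε ^ 2))
    rw [EuclideanSpace.real_norm_sq_eq, Finset.mul_sum, Finset.mul_sum]
    refine Finset.sum_le_sum fun j _ => ?_
    have h1 : deltaEntry z j * u j = ∑ i, (S.ASS j i : ℂ) * u i := by
      have h2 := congrFun hu j
      rw [Matrix.sub_mulVec, Pi.sub_apply, Matrix.mulVec_diagonal, Pi.zero_apply,
        sub_eq_zero] at h2
      exact h2
    -- For a constant weight the wave would be annihilated exactly; only the increment of `w`
    -- survives.
    have h3 : T.val (modulated hw hχ u) k j =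
        (w (k + shiftStep l N j) - w k) * (deltaEntry z j * χ k * u j).re := by
      have h4 : T.val (modulated hw hχ u) k j =
          deltaOp l N np nm (modulated hw hχ u) k j -
            ∑ i, S.ASS j i * modulated hw hχ u k i := by
        rw [hT]
        rfl
      rw [h4, deltaOp_apply, modulated_apply, hχs, sub_mul]
      congr 1
      rw [mul_right_comm, h1, Finset.sum_mul, Complex.re_sum, Finset.mul_sum]
      refine Finset.sum_congr rfl fun i _ => ?_
      rw [modulated_apply, mul_assoc, Complex.re_ofReal_mul, mul_comm (u i)]
      ring
    rw [h3, mul_pow, ← mul_assoc, ← mul_pow ε]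
    have h5 : ‖deltaEntry z j‖ = 1 := by
      obtain ⟨i, j | j⟩ := j <;> simp [deltaEntry, hz.1 i]
    refine mul_le_mul ?_ ?_ (sq_nonneg _) (sq_nonneg _)
    · rw [← sq_abs]
      exact pow_le_pow_left₀ (abs_nonneg _) (hws k j) 2
    · rw [← sq_abs]
      refine pow_le_pow_left₀ (abs_nonneg _) ((Complex.abs_re_le_norm _).trans_eq ?_) 2
      rw [norm_mul, norm_mul, hχ, h5, one_mul, one_mul]
  have hvI : (Matrix.diagonal (deltaEntry z) - S.ASS.map Complex.ofReal) *ᵥ (Complex.I • v) = 0 := by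
    rw [Matrix.mulVec_smul, hv, smul_zero]
  have hnI : ∑ j, ‖(Complex.I • v) j‖ ^ 2 = ∑ j, ‖v j‖ ^ 2 := by simp
  have hb : ∀ u : IntIdx np nm → ℂ,
      (Matrix.diagonal (deltaEntry z) - S.ASS.map Complex.ofReal) *ᵥ u = 0 →
      ‖modulated hw hχ u‖ ^ 2 ≤ (C * ε) ^ 2 * ((∑' k, w k ^ 2) * ∑ j, ‖u j‖ ^ 2) := by
    intro u hu
    calc ‖modulated hw hχ u‖ ^ 2 ≤ (C * ‖T.val (modulated hw hχ u)‖) ^ 2 :=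
          pow_le_pow_left₀ (norm_nonneg _) (hbound _) 2
      _ = C ^ 2 * ‖T.val (modulated hw hχ u)‖ ^ 2 := by ring
      _ ≤ C ^ 2 * (ε ^ 2 * ((∑' k, w k ^ 2) * ∑ j, ‖u j‖ ^ 2)) := by
          gcongr
          exact hsmall u hu
      _ = _ := by ring
  have h1 := hb v hv
  have h2 := hb _ hvI
  rw [hnI] at h2
  have h3 := norm_sq_modulated_add hw hχ v
  have hpos : 0 < (∑' k, w k ^ 2) * ∑ j, ‖v j‖ ^ 2 := by
    refine mul_pos (hw.tsum_pos (fun k => sq_nonneg _) 0 (by have := hwpos 0; positivity)) ?_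
    obtain ⟨j, hj⟩ := Function.ne_iff.1 hv0
    refine Finset.sum_pos' (fun _ _ => by positivity) ⟨j, Finset.mem_univ _, ?_⟩
    have : 0 < ‖v j‖ := norm_pos_iff.2 hj
    positivity
  have h4 : C * ε ≤ 1 / 2 := by
    rw [hε, mul_inv, ← mul_assoc, mul_comm C, mul_assoc, ← div_eq_mul_inv C]
    have : C / (C + 1) ≤ 1 := div_le_one_of_le₀ (by linarith) (by linarith)
    linarith
  have h5 : (C * ε) ^ 2 ≤ 1 / 4 := by
    have : 0 ≤ C * ε := by positivity
    nlinarith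
  nlinarith [mul_le_mul_of_nonneg_right h5 hpos.le]

end WellPosed

/-! ### Evaluation and conjugation of trigonometric polynomials. -/

namespace TrigPoly

variable {L : ℕ}

theorem eval_mul (z : Fin L → ℂ) (hz : ∀ i, z i ≠ 0) (p q : TrigPoly L) :
    eval z (p * q) = eval z p * eval z q := by
  induction p using AddMonoidAlgebra.induction_linear with
  | zero => simp [eval]
  | add p p' hp hp' => rw [add_mul, eval_add, eval_add, hp, hp', add_mul]
  | single d c =>
    induction q using AddMonoidAlgebra.induction_linear with
    | zero => simp [eval]
    | add q q' hq hq' => rw [mul_add, eval_add, eval_add, hq, hq', mul_add]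
    | single d' c' =>
      rw [AddMonoidAlgebra.single_mul_single, eval_single, eval_single, eval_single]
      simp_rw [Pi.add_apply, zpow_add₀ (hz _), Finset.prod_mul_distrib]
      ring

theorem eval_const (z : Fin L → ℂ) (c : ℂ) : eval z (const c : TrigPoly L) = c := by
  simp [const, eval_single]

/-- Evaluation at a point with nonzero coordinates as a ring homomorphism. -/
noncomputable def evalHom (z : Fin L → ℂ) (hz : ∀ i, z i ≠ 0) : TrigPoly L →+* ℂ where
  toFun := eval z
  map_zero' := by simp [eval]
  map_one' := eval_const z 1
  map_add' := eval_add z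
  map_mul' := eval_mul z hz

theorem evalHom_apply (z : Fin L → ℂ) (hz : ∀ i, z i ≠ 0) (p : TrigPoly L) :
    evalHom z hz p = eval z p := rfl

theorem conj_single (d : Fin L → ℤ) (c : ℂ) :
    conj (AddMonoidAlgebra.single d c) = AddMonoidAlgebra.single (-d) (starRingEnd ℂ c) := by
  simp [conj]

theorem coeff_conj (p : TrigPoly L) (d : Fin L → ℤ) :
    (conj p).coeff d = starRingEnd ℂ (p.coeff (-d)) := by
  induction p using AddMonoidAlgebra.induction_linear with
  | zero => simp
  | add p q hp hq => simp [hp, hq]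
  | single e c =>
    rw [conj_single]
    simp only [AddMonoidAlgebra.coeff_single, Finsupp.single_apply]
    by_cases h : e = -d
    · simp [h]
    · rw [if_neg h, if_neg fun h' => h (by rw [← h', neg_neg]), map_zero]

theorem conj_conj (p : TrigPoly L) : conj (conj p) = p := by
  ext d
  simp [coeff_conj]

theorem isHermitian_iff (p : TrigPoly L) : p.IsHermitian ↔ conj p = p := by
  constructor
  · intro h
    ext d
    rw [coeff_conj, h, Complex.conj_conj]
  · intro h d
    conv_lhs => rw [← h]
    rw [coeff_conj, neg_neg]

theorem const_im_eq_zero {c : ℂ} (h : (const c : TrigPoly L).IsHermitian) : (c.re : ℂ) = c := by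
  have := h 0
  simp only [neg_zero, const, AddMonoidAlgebra.coeff_single, Finsupp.single_eq_same] at this
  exact Complex.conj_eq_iff_re.1 this.symm

end TrigPoly

/-! ### The criterion in even degree. -/

namespace RouthHurwitz

open Polynomial

/-- The coefficients of `f` in the first row of the Routh table in degree `2n`. -/
def evenRow {R : Type*} [Semiring R] (n : ℕ) (f : R[X]) (j : ℕ) : R :=
  if j ≤ n then f.coeff (2 * n - 2 * j) else 0

/-- The coefficients of `f` in the second row of the Routh table in degree `2n`. -/
def oddRow {R : Type*} [Semiring R] (n : ℕ) (f : R[X]) (j : ℕ) : R :=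
  if j < n then f.coeff (2 * n - 2 * j - 1) else 0

theorem map_evenRow {R R' : Type*} [Semiring R] [Semiring R'] (g : R →+* R') (n : ℕ) (f : R[X])
    (j : ℕ) : g (evenRow n f j) = evenRow n (f.map g) j := by
  unfold evenRow; split_ifs <;> simp

theorem map_oddRow {R R' : Type*} [Semiring R] [Semiring R'] (g : R →+* R') (n : ℕ) (f : R[X])
    (j : ℕ) : g (oddRow n f j) = oddRow n (f.map g) j := by
  unfold oddRow; split_ifs <;> simp

/-- The Routh–Hurwitz criterion in even degree. -/
theorem isStable_iff {n : ℕ} {f : ℝ[X]} (hdeg : f.natDegree ≤ 2 * n)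
    (hlead : 0 < f.coeff (2 * n)) :
    f.IsStable ↔ ∀ i ≤ 2 * n, 0 < routh (evenRow n f) (oddRow n f) i 0 := by
  set p : ℝ[X] := ∑ k ∈ (Finset.range (2 * n + 1)).filter Even, monomial k (f.coeff k) with hp
  have hpc : ∀ k, p.coeff k = if Even k then f.coeff k else 0 := by
    intro k
    rw [hp, finsetSum_coeff]
    simp_rw [coeff_monomial]
    rw [Finset.sum_ite_eq']
    simp only [Finset.mem_filter, Finset.mem_range]
    by_cases hk : k < 2 * n + 1
    · simp [hk]
    · rw [coeff_eq_zero_of_natDegree_lt (p := f) (by omega)]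
      simp
  have hqc : ∀ k, (f - p).coeff k = if Even k then 0 else f.coeff k := by
    intro k
    rw [coeff_sub, hpc]
    split_ifs <;> simp
  have hle : ∀ k, f.coeff k ≠ 0 → k ≤ 2 * n := fun k hk => (le_natDegree_of_ne_zero hk).trans hdeg
  have := isStable_iff_routh_pos (a := evenRow n f) (b := oddRow n f) (p := p) (q := f - p)
    (n := 2 * n) (fun j hj => if_neg (by omega)) (fun j hj => if_neg (by omega)) ?_ ?_ ?_ ?_ ?_
  · rwa [add_sub_cancel] at this
  · intro k hk
    rw [hpc] at hk
    by_cases he : Even k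
    · rw [if_pos he] at hk
      have := hle k hk
      obtain ⟨m, rfl⟩ := he
      exact ⟨n - m, by omega⟩
    · simp [he] at hk
  · intro k j hk
    rw [hpc, if_pos ⟨n - j, by omega⟩, evenRow, if_pos (by omega)]
    congr 1; omega
  · intro k hk
    rw [hqc] at hk
    by_cases he : Even k
    · simp [he] at hk
    · rw [if_neg he] at hk
      have := hle k hk
      obtain ⟨m, rfl⟩ := Nat.not_even_iff_odd.1 he
      exact ⟨n - m - 1, by omega⟩
  · intro k j hk
    rw [hqc, if_neg (by rw [Nat.even_iff]; omega), oddRow, if_pos (by omega)]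
    congr 1; omega
  · simpa [evenRow] using hlead

end RouthHurwitz

/-! ### From the system to the table of `φ`. -/

namespace SIS

open Polynomial RouthHurwitz

variable {L n₀ : ℕ} {np nm : Fin L → ℕ} (S : SIS L n₀ np nm)

theorem e_eq_routh (i j : ℕ) :
    S.e i j = routh (fun k => algebraMap (TrigPoly L) (TrigRat L) (evenRow n₀ S.phi k))
      (fun k => algebraMap _ _ (oddRow n₀ S.phi k)) i j := by
  induction i using Nat.strong_induction_on generalizing j with
  | _ i ih =>
    match i with
    | 0 => simp only [e, routh, evenRow]; split_ifs <;> simp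
    | 1 => simp only [e, routh, oddRow]; split_ifs <;> simp
    | i + 2 => rw [e, routh, ih i (by omega), ih i (by omega), ih (i + 1) (by omega),
        ih (i + 1) (by omega)]

theorem eHat_eq_routhHat (i : ℕ) :
    S.eHat i = routhHat (fun k => algebraMap (TrigPoly L) (TrigRat L) (evenRow n₀ S.phi k))
      (fun k => algebraMap _ _ (oddRow n₀ S.phi k)) i := by
  induction i using Nat.strong_induction_on with
  | _ i ih =>
    match i with
    | 0 => rfl
    | 1 => rw [eHat, routhHat, e_eq_routh]
    | i + 2 => rw [eHat, routhHat, ih i (by omega), ih (i + 1) (by omega), e_eq_routh]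

/-- The trigonometric polynomial `ē_{i,0}`. -/
noncomputable def eBarPoly (i : ℕ) : TrigPoly L :=
  routhNum (evenRow n₀ S.phi) (oddRow n₀ S.phi) i 0

theorem eBar_eq (i : ℕ) : S.eBar i = algebraMap _ _ (S.eBarPoly i) := by
  rw [eBarPoly, map_routhNum_eq, eBar, e_eq_routh, eHat_eq_routhHat, mul_comm]
  intro k _ h
  exact (map_eq_zero_iff _ (IsFractionRing.injective (TrigPoly L) (TrigRat L))).1 h

/-- Conjugation is an involution, so it swaps the factors `m` and `m_conj`. -/
theorem conj_phi : S.phi.map TrigPoly.conj = S.phi := by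
  have h : (S.mConj).map TrigPoly.conj = S.m := by
    ext k : 1
    simp [mConj, TrigPoly.conj_conj]
  rw [phi, Polynomial.map_mul, h, mul_comm]
  rfl

theorem isHermitian_eBarPoly (i : ℕ) : (S.eBarPoly i).IsHermitian := by
  rw [TrigPoly.isHermitian_iff]
  exact map_routhNum_self _ _ _ (fun j => by rw [map_evenRow, conj_phi])
    (fun j => by rw [map_oddRow, conj_phi]) i 0

section Pointwise

variable {z : Fin L → ℂ}

theorem ne_zero_of_norm_eq_one (hz : ∀ i, ‖z i‖ = 1) (i : Fin L) : z i ≠ 0 := fun h => by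
  simpa [h] using hz i

theorem map_constMat {m n : Type} (hz : ∀ i, z i ≠ 0) (M : Matrix m n ℝ) :
    (constMat L M).map (TrigPoly.evalHom z hz) = M.map Complex.ofReal := by
  ext i j
  exact TrigPoly.eval_const z _

theorem map_pencil (hz : ∀ i, z i ≠ 0) : S.pencil.map (TrigPoly.evalHom z hz) =
    Matrix.diagonal (deltaEntry z) - S.ASS.map Complex.ofReal := by
  rw [pencil, Matrix.map_sub _ (map_sub _), map_constMat, Matrix.diagonal_map (map_zero _)]
  congr 2
  funext ⟨i, j⟩
  have h : ∀ s : ℤ, ∏ k, z k ^ (Pi.single i s : Fin L → ℤ) k = z i ^ s := fun s => by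
    rw [Finset.prod_eq_single i (fun k _ hk => by rw [Pi.single_eq_of_ne hk, zpow_zero]) (by simp),
      Pi.single_eq_same]
  rcases j with j | j
  · rw [TrigPoly.evalHom_apply, deltaMono, TrigPoly.eval_single, h]
    simp [deltaEntry]
  · rw [TrigPoly.evalHom_apply, deltaMono, TrigPoly.eval_single, ← Pi.single_neg, h]
    simp [deltaEntry]

/-- The adjugate is determinant times inverse, so `H = h A`; the factor `h̄` makes the scalar
positive and leaves the signs of the real parts of eigenvalues unchanged. -/
theorem map_K (hz : ∀ i, ‖z i‖ = 1)
    (hdet : (Matrix.diagonal (deltaEntry z) - S.ASS.map Complex.ofReal :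
      Matrix (IntIdx np nm) (IntIdx np nm) ℂ).det ≠ 0) :
    S.K.map (TrigPoly.evalHom z (ne_zero_of_norm_eq_one hz)) =
      ((‖(Matrix.diagonal (deltaEntry z) - S.ASS.map Complex.ofReal :
        Matrix (IntIdx np nm) (IntIdx np nm) ℂ).det‖ ^ 2 : ℝ) : ℂ) • S.A z := by
  have hz0 := ne_zero_of_norm_eq_one hz
  have hpen := S.map_pencil hz0
  set B : Matrix (IntIdx np nm) (IntIdx np nm) ℂ :=
    Matrix.diagonal (deltaEntry z) - S.ASS.map Complex.ofReal with hB
  have hh : TrigPoly.evalHom z hz0 S.h = B.det := by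
    rw [h, RingHom.map_det, RingHom.mapMatrix_apply, hpen]
  have hconj : TrigPoly.evalHom z hz0 (TrigPoly.conj S.h) = starRingEnd ℂ B.det := by
    rw [← hh]; exact TrigPoly.eval_conj z hz _
  have hadj : S.pencil.adjugate.map (TrigPoly.evalHom z hz0) = B.det • B⁻¹ := by
    have := RingHom.map_adjugate (TrigPoly.evalHom z hz0) S.pencil
    rw [RingHom.mapMatrix_apply, RingHom.mapMatrix_apply, hpen] at this
    rw [this, Matrix.inv_def, Ring.inverse_eq_inv', smul_smul, mul_inv_cancel₀ hdet, one_smul]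
  have hsmul : ∀ (c : TrigPoly L) (M : Matrix (Fin n₀) (Fin n₀) (TrigPoly L)),
      (c • M).map (TrigPoly.evalHom z hz0) =
        TrigPoly.evalHom z hz0 c • M.map (TrigPoly.evalHom z hz0) := fun c M => by
    ext i j; simp
  have hH : S.H.map (TrigPoly.evalHom z hz0) = B.det • S.A z := by
    rw [H, Matrix.map_add _ (map_add _), Matrix.map_mul, Matrix.map_mul, hsmul, hadj,
      map_constMat, map_constMat, map_constMat, hh, A, ← hB, smul_add, Matrix.mul_smul,
      Matrix.smul_mul]
  rw [K, hsmul, hH, hconj, smul_smul, Complex.conj_mul']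
  push_cast
  rfl

theorem map_m (hz : ∀ i, z i ≠ 0) : S.m.map (TrigPoly.evalHom z hz) =
    (S.K.map (TrigPoly.evalHom z hz)).charpoly := by
  rw [m, ← Matrix.charpoly_map]

/-- The values of the coefficients of `φ` at points of the unit torus are real. -/
theorem exists_real_phi (hz : ∀ i, ‖z i‖ = 1) : ∃ f : ℝ[X], f.natDegree ≤ 2 * n₀ ∧
    f.coeff (2 * n₀) = 1 ∧
    S.phi.map (TrigPoly.evalHom z (ne_zero_of_norm_eq_one hz)) = f.map Complex.ofRealHom := by
  have hz0 := ne_zero_of_norm_eq_one hz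
  have hm : S.m.Monic := Matrix.charpoly_monic _
  have hmd : S.m.natDegree = n₀ := by rw [m, Matrix.charpoly_natDegree_eq_dim, Fintype.card_fin]
  have hphi : S.phi.Monic := hm.mul (hm.map _)
  have hphid : S.phi.natDegree = 2 * n₀ := by
    rw [phi, mConj, hm.natDegree_mul (hm.map _), hm.natDegree_map, hmd, two_mul]
  have hreal : ∀ k, ∃ c : ℝ, (c : ℂ) = TrigPoly.evalHom z hz0 (S.phi.coeff k) := fun k => by
    have h : starRingEnd ℂ (TrigPoly.eval z (S.phi.coeff k)) = TrigPoly.eval z (S.phi.coeff k) := by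
      rw [← TrigPoly.eval_conj z hz, ← coeff_map, conj_phi]
    exact ⟨_, Complex.conj_eq_iff_re.1 h⟩
  have hlift : S.phi.map (TrigPoly.evalHom z hz0) ∈ lifts Complex.ofRealHom :=
    (lifts_iff_coeff_lifts _).2 fun k => by
      obtain ⟨c, hc⟩ := hreal k
      exact ⟨c, by rw [coeff_map]; exact hc⟩
  obtain ⟨f, hf⟩ := (mem_lifts _).1 hlift
  have hdeg : f.natDegree = 2 * n₀ := by
    rw [← natDegree_map_eq_of_injective Complex.ofRealHom.injective f, hf, hphi.natDegree_map,
      hphid]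
  refine ⟨f, hdeg.le, ?_, hf.symm⟩
  have h1 := congrArg (fun g : ℂ[X] => g.coeff (2 * n₀)) hf
  simp only [coeff_map] at h1
  rw [← hphid, hphi.coeff_natDegree, map_one] at h1
  rw [← hphid]
  exact Complex.ofReal_injective (by simpa using h1)

open scoped ComplexOrder in
/-- At a point of the unit torus where `Δ(z) - A_SS` is invertible, `A(z)` is Hurwitz iff all
`ē_{i,0}(z)` are positive. -/
theorem isHurwitz_iff_eBarPoly_pos (hz : ∀ i, ‖z i‖ = 1)
    (hdet : (Matrix.diagonal (deltaEntry z) - S.ASS.map Complex.ofReal :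
      Matrix (IntIdx np nm) (IntIdx np nm) ℂ).det ≠ 0) :
    IsHurwitz (S.A z) ↔ ∀ i ≤ 2 * n₀, 0 < TrigPoly.eval z (S.eBarPoly i) := by
  have hz0 := ne_zero_of_norm_eq_one hz
  have hK := S.map_K hz hdet
  obtain ⟨f, hfd, hf1, hf⟩ := S.exists_real_phi hz
  set ρ : ℝ := ‖(Matrix.diagonal (deltaEntry z) - S.ASS.map Complex.ofReal :
      Matrix (IntIdx np nm) (IntIdx np nm) ℂ).det‖ ^ 2 with hρ
  have hρ0 : 0 < ρ := by have := norm_pos_iff.2 hdet; positivity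
  -- stability of `φ(·, z)` is the Hurwitz property of `A(z)`
  have hspec : ∀ x : ℂ, ((S.K.map (TrigPoly.evalHom z hz0)).charpoly).eval x = 0 ↔
      (ρ : ℂ)⁻¹ * x ∈ spectrum ℂ (S.A z) := fun x => by
    have hu : (ρ : ℂ) ≠ 0 := Complex.ofReal_ne_zero.2 hρ0.ne'
    rw [← Polynomial.IsRoot.def, ← Matrix.mem_spectrum_iff_isRoot_charpoly, hK]
    conv_lhs => rw [show x = (ρ : ℂ) * ((ρ : ℂ)⁻¹ * x) by field_simp]
    exact spectrum.smul_mem_smul_iff (r := Units.mk0 (ρ : ℂ) hu)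
  have hphi : ∀ x : ℂ, aeval x f = ((S.K.map (TrigPoly.evalHom z hz0)).charpoly).eval x *
      starRingEnd ℂ (((S.K.map (TrigPoly.evalHom z hz0)).charpoly).eval (starRingEnd ℂ x)) := by
    intro x
    have h1 : aeval x f = (f.map Complex.ofRealHom).eval x := (eval_map_algebraMap f x).symm
    have h2 : S.mConj.map (TrigPoly.evalHom z hz0) =
        (S.m.map (TrigPoly.evalHom z hz0)).map (starRingEnd ℂ) := by
      ext k
      simp only [mConj, coeff_map]
      exact TrigPoly.eval_conj z hz _
    rw [h1, ← hf, phi, Polynomial.map_mul, eval_mul, h2, map_m]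
    congr 1
    conv_lhs => rw [← Complex.conj_conj x]
    rw [eval_map_apply]
  have hst : IsHurwitz (S.A z) ↔ f.IsStable := by
    constructor
    · intro h x hx h0
      have key : ∀ y : ℂ, 0 ≤ y.re →
          ((S.K.map (TrigPoly.evalHom z hz0)).charpoly).eval y ≠ 0 := fun y hy h1 => by
        have h2 := h _ ((hspec y).1 h1)
        rw [← Complex.ofReal_inv, Complex.re_ofReal_mul] at h2
        have : 0 ≤ ρ⁻¹ * y.re := by positivity
        linarith
      rw [hphi] at h0
      rcases mul_eq_zero.1 h0 with h1 | h1
      · exact key x hx h1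
      · exact key _ (by simpa using hx) ((map_eq_zero _).1 h1)
    · intro h μ hμ
      by_contra! hre
      refine h (ρ * μ) (by rw [Complex.re_ofReal_mul]; positivity) ?_
      rw [hphi, (hspec _).2, zero_mul]
      rwa [inv_mul_cancel_left₀ (Complex.ofReal_ne_zero.2 hρ0.ne')]
  rw [hst, RouthHurwitz.isStable_iff hfd (by rw [hf1]; exact one_pos), forall_routh_pos_iff]
  -- the normalized table of `f` consists of the values of the table of trigonometric polynomials
  have hval : ∀ i, (∀ k < i, TrigPoly.eval z (S.eBarPoly k) ≠ 0) →
      TrigPoly.eval z (S.eBarPoly i) = ((routhHat (evenRow n₀ f) (oddRow n₀ f) i *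
        routh (evenRow n₀ f) (oddRow n₀ f) i 0 : ℝ) : ℂ) := by
    intro i hi
    have h1 := map_routhNum_eq (TrigPoly.evalHom z hz0) (evenRow n₀ S.phi) (oddRow n₀ S.phi) i 0
      fun k hk h0 => absurd h0 (hi k hk)
    simp_rw [map_evenRow, map_oddRow, hf, ← map_evenRow, ← map_oddRow] at h1
    rw [map_routh, map_routhHat, ← map_mul] at h1
    exact h1
  constructor
  · intro h i
    induction i using Nat.strong_induction_on with
    | _ i ih =>
      intro hi
      rw [hval i fun k hk => (ih k hk (by omega)).ne']
      exact Complex.zero_lt_real.2 (h i hi)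
  · intro h i hi
    have := h i hi
    rw [hval i fun k hk => (h k (by omega)).ne'] at this
    exact Complex.zero_lt_real.1 this

end Pointwise

end SIS

open scoped ComplexOrder in
/-- The first part records that the normalized entries are real-valued trigonometric polynomials,
so that every one of them is either a real constant or one of the `F_k`. -/
theorem theorem2 {L n₀ : ℕ} {np nm : Fin L → ℕ} (S : SIS L n₀ np nm)
    (l : ℕ) (hl : l ≤ L) (N : Fin L → ℕ) (hN : ∀ i : Fin L, l ≤ (i : ℕ) → 0 < N i)
    (hwp : S.WellPosed l N) :
    (∀ i ≤ 2 * n₀, ∃ p : TrigPoly L, p.IsHermitian ∧ S.eBar i = algebraMap _ _ p) ∧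
    ((∀ z ∈ torusG l N, IsHurwitz (S.A z)) ↔
      S.setN = ∅ ∧ ∀ F ∈ S.setF, ∀ z ∈ torusG l N, 0 < TrigPoly.eval z F) := by
  refine ⟨fun i _ => ⟨S.eBarPoly i, S.isHermitian_eBarPoly i, S.eBar_eq i⟩, ?_⟩
  have hinj : Function.Injective (algebraMap (TrigPoly L) (TrigRat L)) :=
    IsFractionRing.injective _ _
  have hiff : (∀ z ∈ torusG l N, IsHurwitz (S.A z)) ↔
      ∀ z ∈ torusG l N, ∀ i ≤ 2 * n₀, 0 < TrigPoly.eval z (S.eBarPoly i) :=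
    forall₂_congr fun z hz =>
      S.isHurwitz_iff_eBarPoly_pos hz.1 (S.det_ne_zero_of_wellPosed hwp hz)
  rw [hiff]
  constructor
  · intro h
    refine ⟨Set.eq_empty_iff_forall_notMem.2 ?_, ?_⟩
    · rintro i ⟨hi, c, hc, hci⟩
      rw [S.eBar_eq] at hci
      have h1 := h (fun _ => 1) ⟨by simp, by simp⟩ i hi
      rw [hinj hci, TrigPoly.eval_const] at h1
      exact absurd (Complex.zero_lt_real.1 h1) (not_lt.2 hc)
    · rintro F ⟨⟨i, hi, hF⟩, -⟩ z hz
      rw [S.eBar_eq] at hF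
      rw [← hinj hF]
      exact h z hz i hi
  · rintro ⟨hN0, hF⟩ z hz i hi
    by_cases hc : ∃ c : ℂ, S.eBarPoly i = TrigPoly.const c
    · obtain ⟨c, hc⟩ := hc
      have hre := TrigPoly.const_im_eq_zero (hc ▸ S.isHermitian_eBarPoly i)
      rw [hc, TrigPoly.eval_const, ← hre]
      refine Complex.zero_lt_real.2 (not_le.1 fun hle => ?_)
      have : i ∈ S.setN := ⟨hi, c.re, hle, by rw [S.eBar_eq, hc, hre]⟩
      rw [hN0] at this
      exact this
    · exact hF _ ⟨⟨i, hi, S.eBar_eq i⟩, hc⟩ z hz
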